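/- Let $m,n\ge 0$ be integers. A MILP-graph $G\in\mathcal G_{m,n}$ encodes a problem $\min_{x\in\mathbb R^n} c^\top x$ subject to $Ax\circ b$, $\ell\le x\le u$, $x_j\in\mathbb Z$ for $j\in I$, where $A\in\mathbb R^{m\times n}$, $b\in\mathbb R^m$, $c\in\mathbb R^n$, $\circ\in\{\le,=,\ge\}^m$, $\ell\in(\mathbb R\cup\{-\infty\})^n$, $u\in(\mathbb R\cup\{+\infty\})^n$ and $I\subset\{1,\dots,n\}$. Constraint node $i\in V=\{1,\dots,m\}$ has the feature $v_i=(b_i,\circ_i)$, variable node $j\in W=\{1,\dots,n\}$ has the feature $w_j=(c_j,\ell_j,u_j,\delta_I(j))$, where $\delta_I(j)\in\{0,1\}$ equals $1$ iff $j\in I$; $i$ and $j$ are joined by an edge of weight $A_{ij}$ if $A_{ij}\ne 0$, and $\mathcal N_W(i)\subset W$, $\mathcal N_V(j)\subset V$ denote the sets of neighbours. $\mathcal G_{m,n}$ carries the product topology, in which all unions ($\mathbb R\cup\{\pm\infty\}$) are disjoint unions and finite sets are discrete. *Strong branching score.* Let the LP relaxation of $G$ (integrality dropped) be feasible and bounded,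 with optimal value $f^*(G)\in\mathbb R$ and optimal solution $x^*$ of smallest $\ell_2$-norm. For $j\notin I$ put $\mathrm{SB}(G)_j=0$. For $j\in I$ put $$\mathrm{SB}(G)_j=\bigl(f^*(G,j,\ell_j,\lfloor x^*_j\rfloor)-f^*(G)\bigr)\cdot\bigl(f^*(G,j,\lceil x^*_j\rceil,u_j)-f^*(G)\bigr)\in[0,+\infty],$$ where $f^*(G,j,l,u)$ is the optimal value ($+\infty$ if infeasible) of the LP relaxation with the bounds of $x_j$ replaced by $l,u$, and $0\cdot\infty=0$. We say that $\mathrm{SB}(G)\in\mathbb R^n$ if the LP relaxation of $G$ is feasible and bounded and all $\mathrm{SB}(G)_j$ are finite. *MP-tractability.* Give two nodes of $V$ (of $W$) the same colour in round $0$ iff they have the same feature. In round $l\ge 1$, give two nodes of $V$ the same colour iff in round $l-1$ they had the same colour and the same multiset of pairs (colour of $j$, $A_{ij}$), $j\in\mathcal N_W(i)$; and two nodes of $W$ the same colour iff in round $l-1$ they had the same colour and the same multiset of pairs (colour of $i$, $A_{ij}$), $i\in\mathcal N_V(j)$ (the Weisfeiler–Lehman test without collisions). The colour partitions get finer from round to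 round and stabilize at partitions $\{I_1,\dots,I_s\}$ of $V$ and $\{J_1,\dots,J_t\}$ of $W$. $G$ is MP-tractable if for all $p,q$ all entries of $(A_{ij})_{i\in I_p,j\in J_q}$ are the same. *Message-passing GNN.* A message-passing GNN $F$ is given by a number of layers $L$ and continuous functions $p^0,q^0$, $p^l,q^l,f^l,g^l$ ($1\le l\le L$), $r$ between feature spaces of arbitrary finite dimensions, where $r$ is real-valued and $f^l(\cdot,0)\equiv 0$, $g^l(\cdot,0)\equiv0$. It computes $s_i^0=p^0(v_i)$, $t_j^0=q^0(w_j)$, $$s_i^l=p^l\Bigl(s_i^{l-1},\sum_{j\in\mathcal N_W(i)}f^l(t_j^{l-1},A_{ij})\Bigr),\qquad t_j^l=q^l\Bigl(t_j^{l-1},\sum_{i\in\mathcal N_V(j)}g^l(s_i^{l-1},A_{ij})\Bigr),$$ and outputs $F(G)\in\mathbb R^n$ with $F(G)_j=r\bigl(\sum_{i\in V}s_i^L,\sum_{j'\in W}t_{j'}^L,t_j^L\bigr)$. **Theorem.** Let $\mathbb P$ be a Borel probability measure on $\mathcal G_{m,n}$ (it is then automatically Borel regular) such that $\mathrm{SB}(G)\in\mathbb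 R^n$ almost surely and $G$ is MP-tractable almost surely. Then for all $\varepsilon,\delta>0$ there is a message-passing GNN $F$ such that the event $\{\mathrm{SB}(G)\in\mathbb R^n,\ \|F(G)-\mathrm{SB}(G)\|\le\delta\}$ is $\mathbb P$-measurable and $$\mathbb P\bigl[\|F(G)-\mathrm{SB}(G)\|\le\delta\bigr]\ge 1-\varepsilon .$$ -/

import Mathlib

open MeasureTheory

/-- The type of a linear constraint: `≤`, `=` or `≥`. -/
inductive ConstraintSense : Type
  | le
  | eq
  | ge

instance : TopologicalSpace ConstraintSense := ⊥

instance : DiscreteTopology ConstraintSense := ⟨rfl⟩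

/-- `a ∘ b` for a constraint of the given type `∘`. -/
def ConstraintSense.Holds : ConstraintSense → ℝ → ℝ → Prop
  | .le, a, b => a ≤ b
  | .eq, a, b => a = b
  | .ge, a, b => b ≤ a

/-- `ℝ ∪ {-∞}` with the disjoint union topology; `Sum.inr ()` is `-∞`. -/
abbrev LowerBound : Type := ℝ ⊕ Unit

/-- `ℝ ∪ {+∞}` with the disjoint union topology; `Sum.inr ()` is `+∞`. -/
abbrev UpperBound : Type := ℝ ⊕ Unit

/-- `l ≤ t`. -/
def LowerBound.Holds (l : LowerBound) (t : ℝ) : Prop :=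
  Sum.elim (fun a : ℝ => a ≤ t) (fun _ => True) l

/-- `t ≤ u`. -/
def UpperBound.Holds (u : UpperBound) (t : ℝ) : Prop :=
  Sum.elim (fun a : ℝ => t ≤ a) (fun _ => True) u

/-- The feature `(b_i, ∘_i)` of a constraint node. -/
abbrev ConstraintFeature : Type := ℝ × ConstraintSense

/-- The feature `(c_j, ℓ_j, u_j, δ_I(j))` of a variable node. -/
abbrev VariableFeature : Type := ℝ × LowerBound × UpperBound × Bool

/-- MILP-graphs with `m` constraint nodes and `n` variable nodes: the data of
`min cᵀx` subject to `Ax ∘ b`, `ℓ ≤ x ≤ u`, and `x_j ∈ ℤ` for `j ∈ I`. -/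
@[ext]
structure MILPGraph (m n : ℕ) : Type where
  /-- the coefficient matrix `A` -/
  coef : Matrix (Fin m) (Fin n) ℝ
  /-- the features of the constraint nodes -/
  conFeat : Fin m → ConstraintFeature
  /-- the features of the variable nodes -/
  varFeat : Fin n → VariableFeature

/-- `MPGNN`s are the message-passing graph neural networks for MILP-graphs, with `depth` message
passing layers and all learnable functions continuous. The functions `p l`, `q l`, `f l`, `g l`
belong to layer number `l + 1`; those with `l ≥ depth` are never used. -/
structure MPGNN : Type where
  /-- the number of message passing layers -/
  depth : ℕ
  /-- dimension of the constraint features `s^l` -/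
  dimV : ℕ → ℕ
  /-- dimension of the variable features `t^l` -/
  dimW : ℕ → ℕ
  /-- dimension of the messages sent to constraints -/
  msgV : ℕ → ℕ
  /-- dimension of the messages sent to variables -/
  msgW : ℕ → ℕ
  p0 : ConstraintFeature → (Fin (dimV 0) → ℝ)
  q0 : VariableFeature → (Fin (dimW 0) → ℝ)
  f : ∀ l : ℕ, (Fin (dimW l) → ℝ) × ℝ → (Fin (msgV l) → ℝ)
  g : ∀ l : ℕ, (Fin (dimV l) → ℝ) × ℝ → (Fin (msgW l) → ℝ)
  p : ∀ l : ℕ, (Fin (dimV l) → ℝ) × (Fin (msgV l) → ℝ) → (Fin (dimV (l + 1)) → ℝ)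
  q : ∀ l : ℕ, (Fin (dimW l) → ℝ) × (Fin (msgW l) → ℝ) → (Fin (dimW (l + 1)) → ℝ)
  r : (Fin (dimV depth) → ℝ) × (Fin (dimW depth) → ℝ) × (Fin (dimW depth) → ℝ) → ℝ
  continuous_p0 : Continuous p0
  continuous_q0 : Continuous q0
  continuous_f : ∀ l, Continuous (f l)
  continuous_g : ∀ l, Continuous (g l)
  continuous_p : ∀ l, Continuous (p l)
  continuous_q : ∀ l, Continuous (q l)
  continuous_r : Continuous r
  f_zero : ∀ l t, f l (t, 0) = 0
  g_zero : ∀ l s, g l (s, 0) = 0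

noncomputable section

namespace MILPGraph

variable {m n : ℕ}

/-- The product topology. -/
instance : TopologicalSpace (MILPGraph m n) :=
  TopologicalSpace.induced
    (fun G : MILPGraph m n => (G.coef, G.conFeat, G.varFeat)) inferInstance

/-- The Borel σ-algebra. -/
instance : MeasurableSpace (MILPGraph m n) := borel (MILPGraph m n)

instance : BorelSpace (MILPGraph m n) := ⟨rfl⟩

/-- `b_i` -/
def rhs (G : MILPGraph m n) (i : Fin m) : ℝ := (G.conFeat i).1

/-- `∘_i` -/
def sense (G : MILPGraph m n) (i : Fin m) : ConstraintSense := (G.conFeat i).2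

/-- `c_j` -/
def cost (G : MILPGraph m n) (j : Fin n) : ℝ := (G.varFeat j).1

/-- `ℓ_j` -/
def lower (G : MILPGraph m n) (j : Fin n) : LowerBound := (G.varFeat j).2.1

/-- `u_j` -/
def upper (G : MILPGraph m n) (j : Fin n) : UpperBound := (G.varFeat j).2.2.1

/-- `δ_I(j)`, true if and only if `j ∈ I` -/
def isInt (G : MILPGraph m n) (j : Fin n) : Bool := (G.varFeat j).2.2.2

/-- The neighbours of a constraint node. -/
def nbrsOfCon (G : MILPGraph m n) (i : Fin m) : Finset (Fin n) :=
  by classical exact Finset.univ.filter fun j => G.coef i j ≠ 0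

/-- The neighbours of a variable node. -/
def nbrsOfVar (G : MILPGraph m n) (j : Fin n) : Finset (Fin m) :=
  by classical exact Finset.univ.filter fun i => G.coef i j ≠ 0

/-! ### Linear relaxation and strong branching scores -/

/-- The feasible set of the LP relaxation. -/
def lpFeasible (G : MILPGraph m n) : Set (EuclideanSpace ℝ (Fin n)) :=
  {x | (∀ i, (G.sense i).Holds (∑ j, G.coef i j * x j) (G.rhs i)) ∧
    ∀ j, (G.lower j).Holds (x j) ∧ (G.upper j).Holds (x j)}

/-- The objective `cᵀx`. -/
def objective (G : MILPGraph m n) (x : EuclideanSpace ℝ (Fin n)) : ℝ :=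
  ∑ j, G.cost j * x j

/-- The LP relaxation is feasible and bounded. -/
def LPFeasibleBounded (G : MILPGraph m n) : Prop :=
  G.lpFeasible.Nonempty ∧ BddBelow (G.objective '' G.lpFeasible)

/-- The optimal objective value of the LP relaxation, `+∞` if it is infeasible. -/
def lpValue (G : MILPGraph m n) : EReal :=
  ⨅ x ∈ G.lpFeasible, (G.objective x : EReal)

/-- The optimal solutions of the LP relaxation. -/
def lpOptimal (G : MILPGraph m n) : Set (EuclideanSpace ℝ (Fin n)) :=
  {x | x ∈ G.lpFeasible ∧ ∀ y ∈ G.lpFeasible, G.objective x ≤ G.objective y}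

/-- `x` is an optimal solution of the LP relaxation with the smallest `ℓ₂`-norm. -/
def IsMinNormOptimal (G : MILPGraph m n) (x : EuclideanSpace ℝ (Fin n)) : Prop :=
  x ∈ G.lpOptimal ∧ ∀ y ∈ G.lpOptimal, ‖x‖ ≤ ‖y‖

open Classical in
/-- The optimal solution of the LP relaxation with the smallest `ℓ₂`-norm. (It exists and is unique
whenever the LP relaxation is feasible and bounded; the value in the other case is irrelevant.) -/
def lpSolution (G : MILPGraph m n) : EuclideanSpace ℝ (Fin n) :=
  if h : ∃ x, G.IsMinNormOptimal x then h.choose else 0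

/-- The problem with the bounds of `x_j` replaced by `l` and `u`. -/
def changeBounds (G : MILPGraph m n) (j : Fin n) (l : LowerBound) (u : UpperBound) :
    MILPGraph m n :=
  { G with varFeat := Function.update G.varFeat j (G.cost j, l, u, G.isInt j) }

/-- The strong branching score of `x_j`, in `[-∞, +∞]`. It is meaningful only if the LP relaxation
is feasible and bounded. -/
def sbScore (G : MILPGraph m n) (j : Fin n) : EReal :=
  if G.isInt j then
    ((G.changeBounds j (G.lower j) (Sum.inl (⌊G.lpSolution j⌋ : ℝ))).lpValue - G.lpValue) *
      ((G.changeBounds j (Sum.inl (⌈G.lpSolution j⌉ : ℝ)) (G.upper j)).lpValue - G.lpValue)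
  else 0

/-- The strong branching score vector of `G` is defined and lies in `ℝⁿ`. -/
def SBFinite (G : MILPGraph m n) : Prop :=
  G.LPFeasibleBounded ∧ ∀ j, ∃ a : ℝ, G.sbScore j = (a : EReal)

/-- The strong branching score vector as an element of `ℝⁿ`, for `G` with `G.SBFinite`. -/
def sbVector (G : MILPGraph m n) : EuclideanSpace ℝ (Fin n) :=
  WithLp.toLp 2 fun j => (G.sbScore j).toReal

/-! ### The Weisfeiler-Lehman test -/

/-- One round of the WL test without collisions, on the level of partitions (a colour is a class of
the partition). Two nodes get the same new colour if and only if they have the same old colour and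
the same multiset of pairs (old colour of a neighbour, weight of the edge to it). -/
def wlStep (G : MILPGraph m n) (C : Setoid (Fin m) × Setoid (Fin n)) :
    Setoid (Fin m) × Setoid (Fin n) :=
  (Setoid.ker fun i : Fin m =>
      ((Quotient.mk C.1 i : Quotient C.1),
        (G.nbrsOfCon i).val.map fun j => ((Quotient.mk C.2 j : Quotient C.2), G.coef i j)),
   Setoid.ker fun j : Fin n =>
      ((Quotient.mk C.2 j : Quotient C.2),
        (G.nbrsOfVar j).val.map fun i => ((Quotient.mk C.1 i : Quotient C.1), G.coef i j)))

/-- The colour partitions of the constraint nodes and of the variable nodes after `l` rounds of the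
WL test (without collisions). -/
def wlPartition (G : MILPGraph m n) : ℕ → Setoid (Fin m) × Setoid (Fin n)
  | 0 => (Setoid.ker G.conFeat, Setoid.ker G.varFeat)
  | l + 1 => G.wlStep (G.wlPartition l)

/-- Two constraint nodes lie in the same class of the stable partition. As the partitions only get
finer from round to round, this means that they have the same colour in all rounds. -/
def StableCon (G : MILPGraph m n) (i i' : Fin m) : Prop := ∀ l, (G.wlPartition l).1 i i'

/-- Two variable nodes lie in the same class of the stable partition. -/
def StableVar (G : MILPGraph m n) (j j' : Fin n) : Prop := ∀ l, (G.wlPartition l).2 j j'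

/-- `G` is message-passing-tractable: all entries of the block of `A` cut out by a class of
constraints and a class of variables of the stable partition are the same. -/
def MPTractable (G : MILPGraph m n) : Prop :=
  ∀ i i' j j', G.StableCon i i' → G.StableVar j j' → G.coef i j = G.coef i' j'

end MILPGraph

namespace MPGNN

variable {m n : ℕ}

/-- The features `(s_i^l)_i` and `(t_j^l)_j` computed by the first `l` layers. -/
def features (F : MPGNN) (G : MILPGraph m n) :
    (l : ℕ) → (Fin m → Fin (F.dimV l) → ℝ) × (Fin n → Fin (F.dimW l) → ℝ)
  | 0 => (fun i => F.p0 (G.conFeat i), fun j => F.q0 (G.varFeat j))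
  | l + 1 =>
    (fun i => F.p l ((F.features G l).1 i,
        ∑ j ∈ G.nbrsOfCon i, F.f l ((F.features G l).2 j, G.coef i j)),
     fun j => F.q l ((F.features G l).2 j,
        ∑ i ∈ G.nbrsOfVar j, F.g l ((F.features G l).1 i, G.coef i j)))

/-- The output `F(G) ∈ ℝⁿ`. -/
def eval (F : MPGNN) (G : MILPGraph m n) : EuclideanSpace ℝ (Fin n) :=
  WithLp.toLp 2 fun j =>
    F.r (∑ i, (F.features G F.depth).1 i, ∑ j', (F.features G F.depth).2 j',
      (F.features G F.depth).2 j)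

end MPGNN

end

/-! Three facts carry the proof. Isomorphism invariance: the minimum-norm LP solution is unique, so
relabelling a graph relabels its scores (`IsIso.sbScore_apply`). Separation: a fixed GNN `wlGNN`,
whose aggregations are power sums in the features and the edge weight, computes features at least as
fine as the WL colours and comparable between graphs. If two MP-tractable graphs agree in both sums
of features and in the features of nodes `j`, `j'`, there are bijections of the nodes that respect
features and send `j` to `j'`. Since the stable blocks of `A` are constant, such bijections form an
isomorphism (`exists_isIso_of_wlFeat_eq`). Hence the readout argument determines the score of a
node. Regularity: the score is a Borel function of `G` (`measurable_sbVector`). Feasibility is a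
closed condition on pairs `(x, G)`, and projections along compact balls preserve closedness. Lusin's
theorem then gives a compact set of large measure, consisting of MP-tractable graphs, on which the
scores are continuous. By compactness they factor continuously through the readout argument, and
Tietze's theorem extends the factor to a readout function. The resulting GNN equals the score
exactly on that set. -/

noncomputable section

/-! ### Invariance of the scores under isomorphism -/

namespace MILPGraph

variable {m n : ℕ}

/-- Permutations `σ` of the constraints and `τ` of the variables that carry `G` to `H`. -/
structure IsIso (G H : MILPGraph m n) (σ : Equiv.Perm (Fin m)) (τ : Equiv.Perm (Fin n)) :
    Prop where
  coef : ∀ i j, H.coef (σ i) (τ j) = G.coef i j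
  conFeat : ∀ i, H.conFeat (σ i) = G.conFeat i
  varFeat : ∀ j, H.varFeat (τ j) = G.varFeat j

/-- The vector `(x_{τ j})_j`. -/
def permute (τ : Equiv.Perm (Fin n)) :
    EuclideanSpace ℝ (Fin n) ≃ₗᵢ[ℝ] EuclideanSpace ℝ (Fin n) :=
  LinearIsometryEquiv.piLpCongrLeft 2 ℝ ℝ τ.symm

@[simp]
theorem permute_apply (τ : Equiv.Perm (Fin n)) (x : EuclideanSpace ℝ (Fin n)) (j : Fin n) :
    permute τ x j = x (τ j) := by
  simp [permute, LinearIsometryEquiv.piLpCongrLeft_apply, Equiv.piCongrLeft']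

theorem convex_lpFeasible (G : MILPGraph m n) : Convex ℝ G.lpFeasible := by
  have key : ∀ (s : ConstraintSense) (r a b y z : ℝ), 0 ≤ a → 0 ≤ b → a + b = 1 →
      s.Holds y r → s.Holds z r → s.Holds (a * y + b * z) r := by
    intro s r a b y z ha hb hab hy hz
    have hr : r = a * r + b * r := by rw [← add_mul, hab, one_mul]
    cases s <;> simp only [ConstraintSense.Holds] at * <;> rw [hr]
    · gcongr
    · rw [hy, hz]
    · gcongr
  intro x hx y hy a b ha hb hab
  refine ⟨fun i => ?_, fun j => ⟨?_, ?_⟩⟩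
  · have := key _ _ a b _ _ ha hb hab (hx.1 i) (hy.1 i)
    convert this using 1
    simp only [PiLp.add_apply, PiLp.smul_apply, smul_eq_mul, Finset.mul_sum,
      ← Finset.sum_add_distrib]
    exact Finset.sum_congr rfl fun j _ => by ring
  · have h1 := (hx.2 j).1
    have h2 := (hy.2 j).1
    cases hl : G.lower j with
    | inr _ => simp [LowerBound.Holds]
    | inl r => rw [hl] at h1 h2; exact key .ge r a b _ _ ha hb hab h1 h2
  · have h1 := (hx.2 j).2
    have h2 := (hy.2 j).2
    cases hl : G.upper j with
    | inr _ => simp [UpperBound.Holds]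
    | inl r => rw [hl] at h1 h2; exact key .le r a b _ _ ha hb hab h1 h2

theorem objective_smul_add (G : MILPGraph m n) (a b : ℝ) (x y : EuclideanSpace ℝ (Fin n)) :
    G.objective (a • x + b • y) = a * G.objective x + b * G.objective y := by
  simp only [objective, PiLp.add_apply, PiLp.smul_apply, smul_eq_mul, Finset.mul_sum,
    ← Finset.sum_add_distrib]
  exact Finset.sum_congr rfl fun j _ => by ring

theorem convex_lpOptimal (G : MILPGraph m n) : Convex ℝ G.lpOptimal := by
  intro x hx y hy a b ha hb hab
  refine ⟨G.convex_lpFeasible hx.1 hy.1 ha hb hab, fun z hz => ?_⟩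
  rw [objective_smul_add]
  calc a * G.objective x + b * G.objective y
      ≤ a * G.objective z + b * G.objective z := by gcongr <;> [exact hx.2 z hz; exact hy.2 z hz]
    _ = G.objective z := by rw [← add_mul, hab, one_mul]

/-- By strict convexity, the midpoint of two distinct minimizers would be optimal with smaller norm.
-/
theorem IsMinNormOptimal.unique {G : MILPGraph m n} {x y : EuclideanSpace ℝ (Fin n)}
    (hx : G.IsMinNormOptimal x) (hy : G.IsMinNormOptimal y) : x = y := by
  by_contra hne
  have hnorm : ‖x‖ = ‖y‖ := le_antisymm (hx.2 y hy.1) (hy.2 x hx.1)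
  have h1 := (norm_midpoint_lt_iff hnorm).2 hne
  rw [smul_add] at h1
  exact absurd (hx.2 _ (G.convex_lpOptimal hx.1 hy.1 (by norm_num) (by norm_num) (by norm_num)))
    (not_le.2 h1)

theorem IsMinNormOptimal.lpSolution_eq {G : MILPGraph m n} {x : EuclideanSpace ℝ (Fin n)}
    (hx : G.IsMinNormOptimal x) : G.lpSolution = x := by
  have h : ∃ x, G.IsMinNormOptimal x := ⟨x, hx⟩
  rw [lpSolution, dif_pos h]
  exact h.choose_spec.unique hx

namespace IsIso

variable {G H : MILPGraph m n} {σ : Equiv.Perm (Fin m)} {τ : Equiv.Perm (Fin n)}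

theorem symm (h : IsIso G H σ τ) : IsIso H G σ.symm τ.symm where
  coef i j := by simpa using (h.coef (σ.symm i) (τ.symm j)).symm
  conFeat i := by simpa using (h.conFeat (σ.symm i)).symm
  varFeat j := by simpa using (h.varFeat (τ.symm j)).symm

theorem permute_mem_lpFeasible (h : IsIso G H σ τ) {x : EuclideanSpace ℝ (Fin n)}
    (hx : x ∈ H.lpFeasible) : permute τ x ∈ G.lpFeasible := by
  refine ⟨fun i => ?_, fun j => ?_⟩
  · have := hx.1 (σ i)
    rw [← Equiv.sum_comp τ] at this
    simpa only [sense, rhs, h.coef, h.conFeat, permute_apply] using this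
  · simpa only [lower, upper, h.varFeat, permute_apply] using hx.2 (τ j)

theorem objective_permute (h : IsIso G H σ τ) (x : EuclideanSpace ℝ (Fin n)) :
    G.objective (permute τ x) = H.objective x := by
  rw [objective, objective, ← Equiv.sum_comp τ fun j => H.cost j * x j]
  simp only [cost, h.varFeat, permute_apply]

theorem lpValue_le (h : IsIso G H σ τ) : G.lpValue ≤ H.lpValue := by
  refine le_iInf₂ fun x hx => ?_
  rw [← h.objective_permute]
  exact iInf₂_le _ (h.permute_mem_lpFeasible hx)

theorem lpValue_eq (h : IsIso G H σ τ) : G.lpValue = H.lpValue :=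
  le_antisymm h.lpValue_le h.symm.lpValue_le

theorem permute_mem_lpOptimal (h : IsIso G H σ τ) {x : EuclideanSpace ℝ (Fin n)}
    (hx : x ∈ H.lpOptimal) : permute τ x ∈ G.lpOptimal := by
  refine ⟨h.permute_mem_lpFeasible hx.1, fun y hy => ?_⟩
  rw [h.objective_permute, ← h.symm.objective_permute y]
  exact hx.2 _ (h.symm.permute_mem_lpFeasible hy)

theorem isMinNormOptimal_permute (h : IsIso G H σ τ) {x : EuclideanSpace ℝ (Fin n)}
    (hx : H.IsMinNormOptimal x) : G.IsMinNormOptimal (permute τ x) := by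
  refine ⟨h.permute_mem_lpOptimal hx.1, fun y hy => ?_⟩
  simpa using hx.2 _ (h.symm.permute_mem_lpOptimal hy)

/-- Uniqueness makes the chosen solution equivariant; the default value `0` is invariant under
permutations. -/
theorem lpSolution_apply (h : IsIso G H σ τ) (j : Fin n) :
    H.lpSolution (τ j) = G.lpSolution j := by
  by_cases hH : ∃ x, H.IsMinNormOptimal x
  · obtain ⟨x, hx⟩ := hH
    rw [hx.lpSolution_eq, (h.isMinNormOptimal_permute hx).lpSolution_eq, permute_apply]
  · have hG : ¬ ∃ x, G.IsMinNormOptimal x := fun ⟨x, hx⟩ =>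
      hH ⟨_, h.symm.isMinNormOptimal_permute hx⟩
    simp [lpSolution, dif_neg hH, dif_neg hG]

theorem changeBounds (h : IsIso G H σ τ) (j : Fin n) (l : LowerBound) (u : UpperBound) :
    IsIso (G.changeBounds j l u) (H.changeBounds (τ j) l u) σ τ where
  coef := h.coef
  conFeat := h.conFeat
  varFeat k := by
    by_cases hk : k = j
    · subst hk
      simp [MILPGraph.changeBounds, cost, isInt, h.varFeat]
    · have hk' : τ k ≠ τ j := τ.injective.ne hk
      simp only [MILPGraph.changeBounds, Function.update_of_ne hk, Function.update_of_ne hk',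
        h.varFeat]

theorem sbScore_apply (h : IsIso G H σ τ) (j : Fin n) : H.sbScore (τ j) = G.sbScore j := by
  have hi : H.isInt (τ j) = G.isInt j := by rw [isInt, isInt, h.varFeat]
  have hl : H.lower (τ j) = G.lower j := by rw [lower, lower, h.varFeat]
  have hu : H.upper (τ j) = G.upper j := by rw [upper, upper, h.varFeat]
  rw [sbScore, sbScore, hi, hl, hu, h.lpSolution_apply, ← h.lpValue_eq,
    ← (h.changeBounds j _ _).lpValue_eq, ← (h.changeBounds j _ _).lpValue_eq]

theorem sbVector_apply (h : IsIso G H σ τ) (j : Fin n) : H.sbVector (τ j) = G.sbVector j :=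
  congrArg EReal.toReal (h.sbScore_apply j)

end IsIso

end MILPGraph

/-! ### Encoding finite multisets by power sums -/

/-- For finitely many points there is a polynomial of total degree at most their number that
vanishes at all of them except a given one. -/
theorem MvPolynomial.exists_eval_ne_zero_of_finset {ι : Type*} [Nonempty ι] (Z : Finset (ι → ℝ))
    (z₀ : ι → ℝ) :
    ∃ p : MvPolynomial ι ℝ, p.totalDegree ≤ Z.card ∧ MvPolynomial.eval z₀ p ≠ 0 ∧
      ∀ z ∈ Z, z ≠ z₀ → MvPolynomial.eval z p = 0 := by
  classical
  have hne : ∀ z : ι → ℝ, ∃ i, z ≠ z₀ → z i ≠ z₀ i := fun z => by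
    by_cases h : z = z₀
    · exact ⟨Classical.arbitrary ι, fun h' => absurd h h'⟩
    · obtain ⟨i, hi⟩ := Function.ne_iff.1 h
      exact ⟨i, fun _ => hi⟩
  choose i hi using hne
  -- One linear factor per point, in a coordinate `i z` where that point differs from `z₀`.
  refine ⟨∏ z ∈ Z.erase z₀, (X (i z) - C (z (i z))), ?_, ?_, ?_⟩
  · refine (totalDegree_finsetProd _ _).trans ?_
    calc ∑ z ∈ Z.erase z₀, (X (i z) - C (z (i z)) : MvPolynomial ι ℝ).totalDegree
        ≤ ∑ z ∈ Z.erase z₀, 1 := Finset.sum_le_sum fun z _ =>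
          (totalDegree_sub_C_le _ _).trans (totalDegree_X _).le
      _ = (Z.erase z₀).card := by simp
      _ ≤ Z.card := Finset.card_erase_le
  · rw [map_prod]
    refine Finset.prod_ne_zero_iff.2 fun z hz => ?_
    simpa [sub_eq_zero] using (hi z (Finset.ne_of_mem_erase hz)).symm
  · intro z hz hz0
    rw [map_prod]
    exact Finset.prod_eq_zero (Finset.mem_erase.2 ⟨hz0, hz⟩) (by simp)

section Encoding

/-- The exponents of the monomials in `(t, a)` that are used to encode multisets. -/
abbrev EncodingIndex (d D : ℕ) : Type := Option (Fin d) → Fin (D + 1)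

/-- The coordinates of `(t, a)`. -/
def encodingPoint {d : ℕ} (x : (Fin d → ℝ) × ℝ) (i : Option (Fin d)) : ℝ :=
  i.elim x.2 x.1

theorem encodingPoint_injective {d : ℕ} :
    Function.Injective (encodingPoint : (Fin d → ℝ) × ℝ → Option (Fin d) → ℝ) := by
  intro x y h
  exact Prod.ext (funext fun i => congrFun h (some i)) (congrFun h none)

theorem continuous_encodingPoint {d : ℕ} :
    Continuous (encodingPoint : (Fin d → ℝ) × ℝ → Option (Fin d) → ℝ) := by
  refine continuous_pi fun i => ?_
  cases i with
  | none => exact continuous_snd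
  | some i => exact (continuous_apply i).comp continuous_fst

/-- The monomials in `(t, a)` with exponents at most `D`, multiplied by `a`. -/
def encode (d D : ℕ) (x : (Fin d → ℝ) × ℝ) : Fin (Fintype.card (EncodingIndex d D)) → ℝ :=
  fun k => x.2 * ∏ i, encodingPoint x i ^ ((Fintype.equivFin (EncodingIndex d D)).symm k i : ℕ)

theorem continuous_encode (d D : ℕ) : Continuous (encode d D) := by
  refine continuous_pi fun k => continuous_snd.mul (continuous_finsetProd _ fun i _ => ?_)
  exact ((continuous_apply i).comp continuous_encodingPoint).pow _

theorem encode_zero (d D : ℕ) (t : Fin d → ℝ) : encode d D (t, 0) = 0 := by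
  ext k; simp [encode]

variable {d D : ℕ} {α β : Type*}

/-- Both sides are the same linear combination of coordinates of the encoded sums: exponents up to
`D` cover every monomial of `p`. -/
theorem sum_mul_eval_eq_of_sum_encode_eq {s : Finset α} {s' : Finset β}
    {z : α → (Fin d → ℝ) × ℝ} {z' : β → (Fin d → ℝ) × ℝ}
    (h : ∑ j ∈ s, encode d D (z j) = ∑ j ∈ s', encode d D (z' j))
    {p : MvPolynomial (Option (Fin d)) ℝ} (hp : p.totalDegree ≤ D) :
    ∑ j ∈ s, (z j).2 * MvPolynomial.eval (encodingPoint (z j)) p =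
      ∑ j ∈ s', (z' j).2 * MvPolynomial.eval (encodingPoint (z' j)) p := by
  simp only [MvPolynomial.eval_eq', Finset.mul_sum]
  rw [Finset.sum_comm, Finset.sum_comm (s := s')]
  refine Finset.sum_congr rfl fun e he => ?_
  have hle : ∀ i, e i < D + 1 := fun i => by
    have h1 := (MvPolynomial.le_totalDegree he).trans hp
    have h2 : e i ≤ e.sum fun _ k => k := by
      rw [Finsupp.sum_fintype _ _ fun _ => rfl]
      exact Finset.single_le_sum (f := fun i => e i) (fun _ _ => Nat.zero_le _)
        (Finset.mem_univ i)
    omega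
  have hk := congrFun h (Fintype.equivFin (EncodingIndex d D) fun i => ⟨e i, hle i⟩)
  simp only [Finset.sum_apply, encode, Equiv.symm_apply_apply] at hk
  simp only [mul_left_comm _ (MvPolynomial.coeff e p), ← Finset.mul_sum]
  rw [hk]

-- A polynomial that isolates `x` turns the weighted sum into the multiplicity of `x` times a
-- constant.
open Classical in
theorem sum_mul_eval_eq_count_mul {r : Finset α} {y : α → (Fin d → ℝ) × ℝ}
    {x : (Fin d → ℝ) × ℝ} {p : MvPolynomial (Option (Fin d)) ℝ}
    (hy : ∀ j ∈ r, encodingPoint (y j) ≠ encodingPoint x →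
      MvPolynomial.eval (encodingPoint (y j)) p = 0) :
    ∑ j ∈ r, (y j).2 * MvPolynomial.eval (encodingPoint (y j)) p =
      (r.val.map y).count x * (x.2 * MvPolynomial.eval (encodingPoint x) p) := by
  rw [Multiset.count_map, ← Finset.filter_val, ← nsmul_eq_mul, Finset.card_val,
    ← Finset.sum_const, Finset.sum_filter]
  refine Finset.sum_congr rfl fun j hj => ?_
  split_ifs with hxy
  · rw [hxy]
  · rw [hy j hj fun hc => hxy (encodingPoint_injective hc).symm, mul_zero]

/-- The sum of the encodings of at most `D` points with nonzero weights in total determines the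
multiset of these points. -/
theorem map_eq_map_of_sum_encode_eq {s : Finset α} {s' : Finset β}
    {z : α → (Fin d → ℝ) × ℝ} {z' : β → (Fin d → ℝ) × ℝ}
    (hD : s.card + s'.card ≤ D) (hz : ∀ j ∈ s, (z j).2 ≠ 0) (hz' : ∀ j ∈ s', (z' j).2 ≠ 0)
    (h : ∑ j ∈ s, encode d D (z j) = ∑ j ∈ s', encode d D (z' j)) :
    s.val.map z = s'.val.map z' := by
  classical
  refine Multiset.ext.2 fun x => ?_
  -- Points of weight zero are invisible to `encode`, but occur on neither side.
  by_cases hx : x.2 = 0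
  · rw [Multiset.count_eq_zero_of_notMem, Multiset.count_eq_zero_of_notMem]
    · intro hmem
      obtain ⟨j, hj, rfl⟩ := Multiset.mem_map.1 hmem
      exact hz' j hj hx
    · intro hmem
      obtain ⟨j, hj, rfl⟩ := Multiset.mem_map.1 hmem
      exact hz j hj hx
  obtain ⟨p, hp, hp0, hpz⟩ := MvPolynomial.exists_eval_ne_zero_of_finset
    (s.image (fun j => encodingPoint (z j)) ∪ s'.image (fun j => encodingPoint (z' j)))
    (encodingPoint x)
  have hp' : p.totalDegree ≤ D := hp.trans <| (Finset.card_union_le _ _).trans <|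
    (add_le_add Finset.card_image_le Finset.card_image_le).trans hD
  have hsum := sum_mul_eval_eq_of_sum_encode_eq h hp'
  rw [sum_mul_eval_eq_count_mul fun j hj => hpz _ (Finset.mem_union_left _ (Finset.mem_image_of_mem _ hj)),
    sum_mul_eval_eq_count_mul fun j hj => hpz _ (Finset.mem_union_right _ (Finset.mem_image_of_mem _ hj))] at hsum
  exact_mod_cast mul_right_cancel₀ (mul_ne_zero hx hp0) hsum

/-- Two families with the same multiset of values differ by a bijection of the index types. -/
theorem exists_equiv_of_map_univ_eq {γ : Type*} [Fintype α] [Fintype β] {z : α → γ} {z' : β → γ}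
    (h : Finset.univ.val.map z = Finset.univ.val.map z') : ∃ e : α ≃ β, ∀ a, z' (e a) = z a := by
  classical
  have hc : ∀ c, Nonempty ({a // z a = c} ≃ {b // z' b = c}) := fun c => by
    refine ⟨Fintype.equivOfCardEq ?_⟩
    have := congrArg (Multiset.count c) h
    rw [Multiset.count_map, Multiset.count_map, ← Finset.filter_val, ← Finset.filter_val,
      Finset.card_val, Finset.card_val] at this
    simpa [Fintype.card_subtype, eq_comm] using this
  exact ⟨Equiv.ofFiberEquiv fun c => (hc c).some, fun a => Equiv.ofFiberEquiv_map _ a⟩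

end Encoding

/-! ### A network that simulates the WL test -/

theorem Fin.append_eq_append_iff {γ : Type*} {a b : ℕ} {x x' : Fin a → γ} {y y' : Fin b → γ} :
    Fin.append x y = Fin.append x' y' ↔ x = x' ∧ y = y' := by
  refine ⟨fun h => ⟨funext fun i => ?_, funext fun i => ?_⟩, by rintro ⟨rfl, rfl⟩; rfl⟩
  · simpa using congrFun h (Fin.castAdd b i)
  · simpa using congrFun h (Fin.natAdd a i)

theorem Fin.sum_append {ι : Type*} (s : Finset ι) {a b : ℕ} (x : ι → Fin a → ℝ)
    (y : ι → Fin b → ℝ) :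
    ∑ i ∈ s, Fin.append (x i) (y i) = Fin.append (∑ i ∈ s, x i) (∑ i ∈ s, y i) := by
  ext k
  refine Fin.addCases (fun k => ?_) (fun k => ?_) k <;> simp [Finset.sum_apply]

theorem Continuous.finAppend {X : Type*} [TopologicalSpace X] {a b : ℕ} {x : X → Fin a → ℝ}
    {y : X → Fin b → ℝ} (hx : Continuous x) (hy : Continuous y) :
    Continuous fun t => Fin.append (x t) (y t) := by
  refine continuous_pi fun k => ?_
  refine Fin.addCases (fun k => ?_) (fun k => ?_) k
  · simpa [Function.comp_def] using (continuous_apply k).comp hx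
  · simpa [Function.comp_def] using (continuous_apply k).comp hy

/-- If `t` determines `c`, then the multiset of pairs `(t, a)` determines that of pairs
`(c, a)`. -/
theorem Multiset.map_prod_eq_of_factorsThrough {β γ δ κ : Type*} {s s' : Multiset β} {t : β → δ}
    {c : β → γ} {a a' : β → κ} (hc : c.FactorsThrough t)
    (h : s.map (fun j => (t j, a j)) = s'.map fun j => (t j, a' j)) :
    s.map (fun j => (c j, a j)) = s'.map fun j => (c j, a' j) := by
  -- The map from values of `t` to values of `c` needs a default outside the range of `t`.
  rcases isEmpty_or_nonempty γ with hγ | hγ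
  · have : IsEmpty β := Function.isEmpty c
    rw [Multiset.eq_zero_of_forall_notMem (s := s) fun j => isEmptyElim j,
      Multiset.eq_zero_of_forall_notMem (s := s') fun j => isEmptyElim j]
    rfl
  · obtain ⟨e, rfl⟩ := (Function.factorsThrough_iff c).1 hc
    simpa using congrArg (Multiset.map (Prod.map e id)) h

namespace ConstraintSense

/-- A number that determines the type of a constraint. -/
def code : ConstraintSense → ℝ
  | .le => 0
  | .eq => 1
  | .ge => 2

theorem code_injective : Function.Injective code := by
  intro a b h
  cases a <;> cases b <;> simp [code] at h ⊢

end ConstraintSense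

/-- The finite part of a bound. -/
def boundValue : ℝ ⊕ Unit → ℝ := Sum.elim id fun _ => 0

/-- The indicator of finite bounds. -/
def boundFlag : ℝ ⊕ Unit → ℝ := Sum.elim (fun _ => 1) fun _ => 0

/-- The infinite bound is an isolated point, so its value may be arbitrary; `boundFlag` tells it
apart from the finite bound `0`. -/
theorem continuous_boundValue : Continuous boundValue := continuous_id.sumElim continuous_const

theorem continuous_boundFlag : Continuous boundFlag := continuous_const.sumElim continuous_const

theorem bound_ext {u v : ℝ ⊕ Unit} (h : boundValue u = boundValue v)
    (h' : boundFlag u = boundFlag v) : u = v := by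
  cases u <;> cases v <;> simp_all [boundValue, boundFlag]

/-- An injective continuous encoding of the features of constraints. -/
def encodeConstraint (v : ConstraintFeature) : Fin 2 → ℝ := ![v.1, v.2.code]

theorem continuous_encodeConstraint : Continuous encodeConstraint := by
  refine continuous_pi fun i => ?_
  fin_cases i
  · exact continuous_fst
  · exact (continuous_of_discreteTopology (f := ConstraintSense.code)).comp continuous_snd

theorem encodeConstraint_injective : Function.Injective encodeConstraint := by
  intro v w h
  exact Prod.ext (congrFun h 0) (ConstraintSense.code_injective (congrFun h 1))

/-- An injective continuous encoding of the features of variables. -/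
def encodeVariable (w : VariableFeature) : Fin 6 → ℝ :=
  ![w.1, boundValue w.2.1, boundFlag w.2.1, boundValue w.2.2.1, boundFlag w.2.2.1,
    if w.2.2.2 then 1 else 0]

theorem continuous_encodeVariable : Continuous encodeVariable := by
  refine continuous_pi fun i => ?_
  fin_cases i
  · exact continuous_fst
  · exact continuous_boundValue.comp (by fun_prop)
  · exact continuous_boundFlag.comp (by fun_prop)
  · exact continuous_boundValue.comp (by fun_prop)
  · exact continuous_boundFlag.comp (by fun_prop)
  · exact (continuous_of_discreteTopology (f := fun b : Bool => if b then (1 : ℝ) else 0)).comp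
      (by fun_prop : Continuous fun w : VariableFeature => w.2.2.2)

theorem encodeVariable_injective : Function.Injective encodeVariable := by
  rintro ⟨c, l, u, b⟩ ⟨c', l', u', b'⟩ h
  have h0 : c = c' := congrFun h 0
  have hl : l = l' := bound_ext (congrFun h 1) (congrFun h 2)
  have hu : u = u' := bound_ext (congrFun h 3) (congrFun h 4)
  have hb : (if b then (1 : ℝ) else 0) = if b' then 1 else 0 := congrFun h 5
  have hb' : b = b' := by cases b <;> cases b' <;> simp_all
  rw [h0, hl, hu, hb']

/-- The number of monomials used by `encode d D`. -/
abbrev encodeDim (d D : ℕ) : ℕ := Fintype.card (EncodingIndex d D)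

/-- The dimensions of the features of constraints and variables in the layers of `wlGNN`. -/
def wlDim (D : ℕ) : ℕ → ℕ × ℕ
  | 0 => (2, 6)
  | l + 1 =>
    ((wlDim D l).1 + encodeDim (wlDim D l).2 D + encodeDim (wlDim D l).1 D,
      (wlDim D l).2 + encodeDim (wlDim D l).1 D + encodeDim (wlDim D l).2 D)

/-- A message-passing GNN, with arbitrary readout, that simulates the Weisfeiler-Lehman test: a new
feature consists of the old one, an encoding of the multiset of messages, and the moments of the old
feature, whose sums over all nodes determine the multiset of old features. -/
def wlGNN (D L : ℕ)
    (r : C((Fin (wlDim D L).1 → ℝ) × (Fin (wlDim D L).2 → ℝ) × (Fin (wlDim D L).2 → ℝ), ℝ)) :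
    MPGNN where
  depth := L
  dimV l := (wlDim D l).1
  dimW l := (wlDim D l).2
  msgV l := encodeDim (wlDim D l).2 D
  msgW l := encodeDim (wlDim D l).1 D
  p0 := encodeConstraint
  q0 := encodeVariable
  f l := encode (wlDim D l).2 D
  g l := encode (wlDim D l).1 D
  -- The weight `1` is nonzero, so the sum of the last block over all nodes recovers the multiset of
  -- old features.
  p l x := Fin.append (Fin.append x.1 x.2) (encode (wlDim D l).1 D (x.1, 1))
  q l x := Fin.append (Fin.append x.1 x.2) (encode (wlDim D l).2 D (x.1, 1))
  r := r
  continuous_p0 := continuous_encodeConstraint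
  continuous_q0 := continuous_encodeVariable
  continuous_f _ := continuous_encode _ _
  continuous_g _ := continuous_encode _ _
  continuous_p _ := (continuous_fst.finAppend continuous_snd).finAppend
    ((continuous_encode _ _).comp (continuous_fst.prodMk continuous_const))
  continuous_q _ := (continuous_fst.finAppend continuous_snd).finAppend
    ((continuous_encode _ _).comp (continuous_fst.prodMk continuous_const))
  continuous_r := r.continuous
  f_zero _ _ := encode_zero _ _ _
  g_zero _ _ := encode_zero _ _ _

namespace MILPGraph

variable {m n : ℕ}

/-- The features of the constraints computed by `wlGNN`. -/
def wlFeatV (D : ℕ) (G : MILPGraph m n) (l : ℕ) : Fin m → Fin (wlDim D l).1 → ℝ :=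
  ((wlGNN D 0 0).features G l).1

/-- The features of the variables computed by `wlGNN`. -/
def wlFeatW (D : ℕ) (G : MILPGraph m n) (l : ℕ) : Fin n → Fin (wlDim D l).2 → ℝ :=
  ((wlGNN D 0 0).features G l).2

theorem wlFeatV_succ (D : ℕ) (G : MILPGraph m n) (l : ℕ) (i : Fin m) :
    G.wlFeatV D (l + 1) i = Fin.append (Fin.append (G.wlFeatV D l i)
      (∑ j ∈ G.nbrsOfCon i, encode _ D (G.wlFeatW D l j, G.coef i j)))
      (encode _ D (G.wlFeatV D l i, 1)) := rfl

theorem wlFeatW_succ (D : ℕ) (G : MILPGraph m n) (l : ℕ) (j : Fin n) :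
    G.wlFeatW D (l + 1) j = Fin.append (Fin.append (G.wlFeatW D l j)
      (∑ i ∈ G.nbrsOfVar j, encode _ D (G.wlFeatV D l i, G.coef i j)))
      (encode _ D (G.wlFeatW D l j, 1)) := rfl

/-- Depth and readout do not influence the layers, so the features can be studied for one fixed
choice of both. -/
theorem features_wlGNN {D L : ℕ} (r) (G : MILPGraph m n) (l : ℕ) :
    (wlGNN D L r).features G l = (G.wlFeatV D l, G.wlFeatW D l) := by
  induction l with
  | zero => rfl
  | succ l ih =>
    exact congrArg (fun X : (Fin m → Fin (wlDim D l).1 → ℝ) × (Fin n → Fin (wlDim D l).2 → ℝ) =>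
      ((fun i => Fin.append (Fin.append (X.1 i)
          (∑ j ∈ G.nbrsOfCon i, encode _ D (X.2 j, G.coef i j))) (encode _ D (X.1 i, 1)),
        fun j => Fin.append (Fin.append (X.2 j)
          (∑ i ∈ G.nbrsOfVar j, encode _ D (X.1 i, G.coef i j))) (encode _ D (X.2 j, 1))) :
        (Fin m → Fin (wlDim D (l + 1)).1 → ℝ) × (Fin n → Fin (wlDim D (l + 1)).2 → ℝ))) ih

/-! ### What the features determine -/

section Separation

variable {D : ℕ} {G H : MILPGraph m n} {l : ℕ}

theorem mem_nbrsOfCon {i : Fin m} {j : Fin n} : j ∈ G.nbrsOfCon i ↔ G.coef i j ≠ 0 := by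
  simp [nbrsOfCon]

theorem mem_nbrsOfVar {i : Fin m} {j : Fin n} : i ∈ G.nbrsOfVar j ↔ G.coef i j ≠ 0 := by
  simp [nbrsOfVar]

theorem wlFeatV_of_succ {i i' : Fin m} (h : G.wlFeatV D (l + 1) i = H.wlFeatV D (l + 1) i') :
    G.wlFeatV D l i = H.wlFeatV D l i' := by
  rw [wlFeatV_succ, wlFeatV_succ] at h
  exact (Fin.append_eq_append_iff.1 (Fin.append_eq_append_iff.1 h).1).1

theorem wlFeatW_of_succ {j j' : Fin n} (h : G.wlFeatW D (l + 1) j = H.wlFeatW D (l + 1) j') :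
    G.wlFeatW D l j = H.wlFeatW D l j' := by
  rw [wlFeatW_succ, wlFeatW_succ] at h
  exact (Fin.append_eq_append_iff.1 (Fin.append_eq_append_iff.1 h).1).1

theorem conFeat_eq_of_wlFeatV {i i' : Fin m} (h : G.wlFeatV D l i = H.wlFeatV D l i') :
    G.conFeat i = H.conFeat i' := by
  induction l with
  | zero => exact encodeConstraint_injective h
  | succ l ih => exact ih (wlFeatV_of_succ h)

theorem varFeat_eq_of_wlFeatW {j j' : Fin n} (h : G.wlFeatW D l j = H.wlFeatW D l j') :
    G.varFeat j = H.varFeat j' := by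
  induction l with
  | zero => exact encodeVariable_injective h
  | succ l ih => exact ih (wlFeatW_of_succ h)

/-- The middle block encodes the neighbours. Twice the number of nodes bounds the degree needed,
since the points of two graphs are separated at once. -/
theorem map_nbrsOfCon_eq_of_wlFeatV (hn : n + n ≤ D) {i i' : Fin m}
    (h : G.wlFeatV D (l + 1) i = H.wlFeatV D (l + 1) i') :
    (G.nbrsOfCon i).val.map (fun j => (G.wlFeatW D l j, G.coef i j)) =
      (H.nbrsOfCon i').val.map fun j => (H.wlFeatW D l j, H.coef i' j) := by
  rw [wlFeatV_succ, wlFeatV_succ] at h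
  refine map_eq_map_of_sum_encode_eq ?_ (fun j hj => mem_nbrsOfCon.1 hj)
    (fun j hj => mem_nbrsOfCon.1 hj)
    (Fin.append_eq_append_iff.1 (Fin.append_eq_append_iff.1 h).1).2
  exact (add_le_add (card_finset_fin_le _) (card_finset_fin_le _)).trans hn

theorem map_nbrsOfVar_eq_of_wlFeatW (hm : m + m ≤ D) {j j' : Fin n}
    (h : G.wlFeatW D (l + 1) j = H.wlFeatW D (l + 1) j') :
    (G.nbrsOfVar j).val.map (fun i => (G.wlFeatV D l i, G.coef i j)) =
      (H.nbrsOfVar j').val.map fun i => (H.wlFeatV D l i, H.coef i j') := by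
  rw [wlFeatW_succ, wlFeatW_succ] at h
  refine map_eq_map_of_sum_encode_eq ?_ (fun i hi => mem_nbrsOfVar.1 hi)
    (fun i hi => mem_nbrsOfVar.1 hi)
    (Fin.append_eq_append_iff.1 (Fin.append_eq_append_iff.1 h).1).2
  exact (add_le_add (card_finset_fin_le _) (card_finset_fin_le _)).trans hm

/-- Only the sum of the moment block is used; it describes the features one layer earlier, which
costs one layer. -/
theorem exists_equiv_of_sum_wlFeatV_eq (hm : m + m ≤ D)
    (h : ∑ i, G.wlFeatV D (l + 1) i = ∑ i, H.wlFeatV D (l + 1) i) :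
    ∃ σ : Equiv.Perm (Fin m), ∀ i, H.wlFeatV D l (σ i) = G.wlFeatV D l i := by
  simp only [wlFeatV_succ] at h
  replace h := (Fin.sum_append _ _ _).symm.trans (h.trans (Fin.sum_append _ _ _))
  have hmap := map_eq_map_of_sum_encode_eq (z := fun i => (G.wlFeatV D l i, (1 : ℝ)))
    (z' := fun i => (H.wlFeatV D l i, (1 : ℝ))) (by simpa using hm) (fun _ _ => one_ne_zero)
    (fun _ _ => one_ne_zero) (Fin.append_eq_append_iff.1 h).2
  obtain ⟨σ, hσ⟩ := exists_equiv_of_map_univ_eq hmap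
  exact ⟨σ, fun i => congrArg Prod.fst (hσ i)⟩

theorem exists_equiv_of_sum_wlFeatW_eq (hn : n + n ≤ D)
    (h : ∑ j, G.wlFeatW D (l + 1) j = ∑ j, H.wlFeatW D (l + 1) j) :
    ∃ τ : Equiv.Perm (Fin n), ∀ j, H.wlFeatW D l (τ j) = G.wlFeatW D l j := by
  simp only [wlFeatW_succ] at h
  replace h := (Fin.sum_append _ _ _).symm.trans (h.trans (Fin.sum_append _ _ _))
  have hmap := map_eq_map_of_sum_encode_eq (z := fun j => (G.wlFeatW D l j, (1 : ℝ)))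
    (z' := fun j => (H.wlFeatW D l j, (1 : ℝ))) (by simpa using hn) (fun _ _ => one_ne_zero)
    (fun _ _ => one_ne_zero) (Fin.append_eq_append_iff.1 h).2
  obtain ⟨τ, hτ⟩ := exists_equiv_of_map_univ_eq hmap
  exact ⟨τ, fun j => congrArg Prod.fst (hτ j)⟩

/-- The features computed by `wlGNN` are at least as fine as the colours of the WL test. -/
theorem wlPartition_of_wlFeat_eq (hm : m + m ≤ D) (hn : n + n ≤ D) (G : MILPGraph m n) (l : ℕ) :
    (∀ i i', G.wlFeatV D l i = G.wlFeatV D l i' → (G.wlPartition l).1 i i') ∧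
      ∀ j j', G.wlFeatW D l j = G.wlFeatW D l j' → (G.wlPartition l).2 j j' := by
  induction l with
  | zero =>
    exact ⟨fun i i' h => encodeConstraint_injective h, fun j j' h => encodeVariable_injective h⟩
  | succ l ih =>
    refine ⟨fun i i' h => Prod.ext ?_ ?_, fun j j' h => Prod.ext ?_ ?_⟩
    · exact Quotient.sound (ih.1 _ _ (wlFeatV_of_succ h))
    · exact Multiset.map_prod_eq_of_factorsThrough
        (fun j j' hj => Quotient.sound (ih.2 j j' hj)) (map_nbrsOfCon_eq_of_wlFeatV hn h)
    · exact Quotient.sound (ih.2 _ _ (wlFeatW_of_succ h))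
    · exact Multiset.map_prod_eq_of_factorsThrough
        (fun i i' hi => Quotient.sound (ih.1 i i' hi)) (map_nbrsOfVar_eq_of_wlFeatW hm h)

end Separation

/-! ### Stabilization of the WL test -/

theorem wlStep_le (G : MILPGraph m n) (C : Setoid (Fin m) × Setoid (Fin n)) :
    G.wlStep C ≤ C :=
  ⟨fun _ _ h => Quotient.exact (congrArg Prod.fst h),
    fun _ _ h => Quotient.exact (congrArg Prod.fst h)⟩

theorem antitone_wlPartition (G : MILPGraph m n) : Antitone G.wlPartition :=
  antitone_nat_of_succ_le fun l => G.wlStep_le (G.wlPartition l)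

instance {α : Type*} [Finite α] : Finite (Setoid α) :=
  Finite.of_injective (fun s : Setoid α => (s : α → α → Prop)) fun _ _ h =>
    Setoid.ext fun a b => iff_of_eq (congrFun (congrFun h a) b)

/-- A number of rounds after which the WL test has stabilized. -/
def wlRounds (m n : ℕ) : ℕ := Nat.card (Setoid (Fin m) × Setoid (Fin n))

/-- By the pigeonhole principle a partition recurs within `wlRounds m n` rounds. As partitions only
get finer, two consecutive ones coincide there, and the sequence is constant from then on. -/
theorem wlPartition_wlRounds_le (G : MILPGraph m n) (l : ℕ) :
    G.wlPartition (wlRounds m n) ≤ G.wlPartition l := by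
  classical
  have := Fintype.ofFinite (Setoid (Fin m) × Setoid (Fin n))
  obtain ⟨a, b, hne, hab⟩ := Fintype.exists_ne_map_eq_of_card_lt
    (fun k : Fin (wlRounds m n + 1) => G.wlPartition k)
    (by simp [wlRounds, Nat.card_eq_fintype_card])
  wlog hlt : a < b generalizing a b
  · exact this b a hne.symm hab.symm (lt_of_le_of_ne (not_lt.1 hlt) hne.symm)
  have hstep : G.wlPartition (a + 1) = G.wlPartition a :=
    le_antisymm (G.antitone_wlPartition (Nat.le_succ _))
      (hab.le.trans (G.antitone_wlPartition hlt))
  have hstable : ∀ k, G.wlPartition (a + k) = G.wlPartition a := by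
    intro k
    induction k with
    | zero => rfl
    | succ k ih =>
      rw [← hstep, ← add_assoc]
      change G.wlStep (G.wlPartition (a + k)) = G.wlStep (G.wlPartition a)
      rw [ih]
  calc G.wlPartition (wlRounds m n) ≤ G.wlPartition a :=
        G.antitone_wlPartition (Nat.lt_succ_iff.1 a.2)
    _ = G.wlPartition (a + l) := (hstable l).symm
    _ ≤ G.wlPartition l := G.antitone_wlPartition (Nat.le_add_left _ _)

/-! ### From equal features to an isomorphism -/

section Iso

variable {D : ℕ} {G H : MILPGraph m n}

theorem stableVar_of_wlFeatW_eq (hm : m + m ≤ D) (hn : n + n ≤ D) {j j' : Fin n}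
    (h : G.wlFeatW D (wlRounds m n) j = G.wlFeatW D (wlRounds m n) j') : G.StableVar j j' :=
  fun l => (G.wlPartition_wlRounds_le l).2 ((G.wlPartition_of_wlFeat_eq hm hn _).2 j j' h)

/-- In an MP-tractable graph a nonzero entry is determined by the features of its row and
column. -/
theorem MPTractable.coef_eq_of_ne_zero (hG : G.MPTractable) (hm : m + m ≤ D) (hn : n + n ≤ D)
    {i i' : Fin m} {j j' : Fin n}
    (hi : G.wlFeatV D (wlRounds m n + 1) i = H.wlFeatV D (wlRounds m n + 1) i')
    (hj : G.wlFeatW D (wlRounds m n) j = H.wlFeatW D (wlRounds m n) j')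
    (h0 : H.coef i' j' ≠ 0) : G.coef i j = H.coef i' j' := by
  have hmem : (H.wlFeatW D (wlRounds m n) j', H.coef i' j') ∈
      (H.nbrsOfCon i').val.map fun k => (H.wlFeatW D (wlRounds m n) k, H.coef i' k) :=
    Multiset.mem_map.2 ⟨j', mem_nbrsOfCon.2 h0, rfl⟩
  rw [← map_nbrsOfCon_eq_of_wlFeatV hn hi] at hmem
  obtain ⟨k, -, hk⟩ := Multiset.mem_map.1 hmem
  rw [Prod.mk.injEq] at hk
  rw [← hk.2]
  -- The matching pair found in row `i` of `G` lies in a column `k` in the stable class of `j`, so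
  -- tractability gives equal entries in columns `j` and `k`.
  exact hG _ _ _ _ (fun l => Setoid.refl' _ _) (stableVar_of_wlFeatW_eq hm hn (hj.trans hk.1.symm))

/-- MP-tractable graphs with the same final features are isomorphic. -/
theorem exists_isIso_of_wlFeat_eq (hm : m + m ≤ D) (hn : n + n ≤ D) (hG : G.MPTractable)
    (hH : H.MPTractable)
    (hV : ∑ i, G.wlFeatV D (wlRounds m n + 2) i = ∑ i, H.wlFeatV D (wlRounds m n + 2) i)
    (hW : ∑ j, G.wlFeatW D (wlRounds m n + 2) j = ∑ j, H.wlFeatW D (wlRounds m n + 2) j)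
    {j j' : Fin n}
    (hj : G.wlFeatW D (wlRounds m n + 2) j = H.wlFeatW D (wlRounds m n + 2) j') :
    ∃ σ τ, IsIso G H σ τ ∧ τ j = j' := by
  -- Of the two layers beyond `wlRounds m n`, one is spent on obtaining bijections from sums, the
  -- other on reading off neighbours.
  obtain ⟨σ, hσ⟩ := exists_equiv_of_sum_wlFeatV_eq hm hV
  obtain ⟨τ₀, hτ₀⟩ := exists_equiv_of_sum_wlFeatW_eq hn hW
  have hj' := wlFeatW_of_succ hj
  obtain ⟨τ, hτ, hτj⟩ : ∃ τ : Equiv.Perm (Fin n),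
      (∀ k, H.wlFeatW D (wlRounds m n + 1) (τ k) = G.wlFeatW D (wlRounds m n + 1) k) ∧
        τ j = j' := by
    -- The swap respects features because `τ₀ j` and `j'` have the same one.
    refine ⟨τ₀.trans (Equiv.swap (τ₀ j) j'), fun k => ?_, by simp⟩
    rw [← hτ₀ k, Equiv.trans_apply]
    rcases eq_or_ne (τ₀ k) (τ₀ j) with h1 | h1
    · rw [h1, Equiv.swap_apply_left, hτ₀ j, hj']
    rcases eq_or_ne (τ₀ k) j' with h2 | h2
    · rw [h2, Equiv.swap_apply_right, hτ₀ j, hj']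
    · rw [Equiv.swap_apply_of_ne_of_ne h1 h2]
  refine ⟨σ, τ, ⟨fun i k => ?_, fun i => conFeat_eq_of_wlFeatV (hσ i),
    fun k => varFeat_eq_of_wlFeatW (hτ k)⟩, hτj⟩
  -- Neighbourhoods show only nonzero entries, so whichever of the two entries is nonzero forces the
  -- other to equal it.
  by_cases h0 : H.coef (σ i) (τ k) = 0
  · by_contra hne
    rw [h0] at hne
    exact hne (h0.symm.trans (hH.coef_eq_of_ne_zero hm hn (hσ i) (wlFeatW_of_succ (hτ k))
      (Ne.symm hne)))
  · exact (hG.coef_eq_of_ne_zero hm hn (hσ i).symm (wlFeatW_of_succ (hτ k)).symm h0).symm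

end Iso

end MILPGraph

namespace MILPGraph

variable {m n : ℕ}

/-! ### Topology of the space of MILP-graphs -/

/-- The space of MILP-graphs is a product. -/
def homeomorphProd :
    MILPGraph m n ≃ₜ
      (Fin m → Fin n → ℝ) × (Fin m → ConstraintFeature) × (Fin n → VariableFeature) where
  toFun G := (G.coef, G.conFeat, G.varFeat)
  invFun x := ⟨x.1, x.2.1, x.2.2⟩
  left_inv _ := rfl
  right_inv _ := rfl
  continuous_toFun := continuous_induced_dom
  continuous_invFun := continuous_induced_rng.2 continuous_id

instance : Finite ConstraintSense :=
  Finite.of_surjective (![.le, .eq, .ge] : Fin 3 → ConstraintSense) fun s => by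
    cases s
    exacts [⟨0, rfl⟩, ⟨1, rfl⟩, ⟨2, rfl⟩]

-- Pseudometrizability and σ-compactness supply the inner regularity by compact sets that Lusin's
-- theorem needs.
set_option synthInstance.maxSize 2000 in
instance : TopologicalSpace.PseudoMetrizableSpace (MILPGraph m n) :=
  homeomorphProd.isInducing.pseudoMetrizableSpace

instance : T2Space (MILPGraph m n) := homeomorphProd.isEmbedding.t2Space

set_option synthInstance.maxSize 2000 in
instance : SigmaCompactSpace (MILPGraph m n) := homeomorphProd.isClosedEmbedding.sigmaCompactSpace

instance : SecondCountableTopology (MILPGraph m n) :=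
  homeomorphProd.secondCountableTopology

theorem continuous_coef (i : Fin m) (j : Fin n) :
    Continuous fun G : MILPGraph m n => G.coef i j :=
  (continuous_apply_apply i j).comp (continuous_fst.comp homeomorphProd.continuous)

theorem continuous_conFeat (i : Fin m) : Continuous fun G : MILPGraph m n => G.conFeat i :=
  (continuous_apply i).comp (continuous_fst.comp (continuous_snd.comp homeomorphProd.continuous))

theorem continuous_varFeat (j : Fin n) : Continuous fun G : MILPGraph m n => G.varFeat j :=
  (continuous_apply j).comp (continuous_snd.comp (continuous_snd.comp homeomorphProd.continuous))

theorem continuous_rhs (i : Fin m) : Continuous fun G : MILPGraph m n => G.rhs i :=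
  continuous_fst.comp (continuous_conFeat i)

theorem continuous_sense (i : Fin m) : Continuous fun G : MILPGraph m n => G.sense i :=
  continuous_snd.comp (continuous_conFeat i)

theorem continuous_cost (j : Fin n) : Continuous fun G : MILPGraph m n => G.cost j :=
  continuous_fst.comp (continuous_varFeat j)

theorem continuous_lower (j : Fin n) : Continuous fun G : MILPGraph m n => G.lower j :=
  continuous_fst.comp (continuous_snd.comp (continuous_varFeat j))

theorem continuous_upper (j : Fin n) : Continuous fun G : MILPGraph m n => G.upper j :=
  continuous_fst.comp (continuous_snd.comp (continuous_snd.comp (continuous_varFeat j)))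

theorem continuous_isInt (j : Fin n) : Continuous fun G : MILPGraph m n => G.isInt j :=
  continuous_snd.comp (continuous_snd.comp (continuous_snd.comp (continuous_varFeat j)))

theorem continuous_changeBounds (j : Fin n) {l : MILPGraph m n → LowerBound}
    {u : MILPGraph m n → UpperBound} (hl : Continuous l) (hu : Continuous u) :
    Continuous fun G : MILPGraph m n => G.changeBounds j (l G) (u G) := by
  refine continuous_induced_rng.2 ?_
  have hp := (homeomorphProd (m := m) (n := n)).continuous
  refine (continuous_fst.comp hp).prodMk ((continuous_fst.comp (continuous_snd.comp hp)).prodMk ?_)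
  exact (continuous_snd.comp (continuous_snd.comp hp)).update j
    ((continuous_cost j).prodMk (hl.prodMk (hu.prodMk (continuous_isInt j))))

end MILPGraph

/-! ### Continuity of message-passing GNNs -/

namespace MPGNN

open MILPGraph

variable {m n : ℕ}

/-- Non-neighbours contribute `f l (t, 0) = 0`. Summing over all nodes removes the dependence on the
edge set, which jumps when an entry tends to zero. -/
theorem features_succ_fst (F : MPGNN) (G : MILPGraph m n) (l : ℕ) (i : Fin m) :
    (F.features G (l + 1)).1 i = F.p l ((F.features G l).1 i,
      ∑ j, F.f l ((F.features G l).2 j, G.coef i j)) := by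
  refine congrArg (fun s => F.p l ((F.features G l).1 i, s)) ?_
  refine Finset.sum_subset (Finset.subset_univ _) fun j _ hj => ?_
  rw [not_ne_iff.1 (mem_nbrsOfCon.not.1 hj), F.f_zero]

theorem features_succ_snd (F : MPGNN) (G : MILPGraph m n) (l : ℕ) (j : Fin n) :
    (F.features G (l + 1)).2 j = F.q l ((F.features G l).2 j,
      ∑ i, F.g l ((F.features G l).1 i, G.coef i j)) := by
  refine congrArg (fun s => F.q l ((F.features G l).2 j, s)) ?_
  refine Finset.sum_subset (Finset.subset_univ _) fun i _ hi => ?_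
  rw [not_ne_iff.1 (mem_nbrsOfVar.not.1 hi), F.g_zero]

theorem continuous_features (F : MPGNN) (l : ℕ) :
    (∀ i, Continuous fun G : MILPGraph m n => (F.features G l).1 i) ∧
      ∀ j, Continuous fun G : MILPGraph m n => (F.features G l).2 j := by
  induction l with
  | zero =>
    exact ⟨fun i => F.continuous_p0.comp (continuous_conFeat i),
      fun j => F.continuous_q0.comp (continuous_varFeat j)⟩
  | succ l ih =>
    refine ⟨fun i => ?_, fun j => ?_⟩
    · simp only [features_succ_fst]
      exact (F.continuous_p l).comp ((ih.1 i).prodMk (continuous_finsetSum _ fun j _ =>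
        (F.continuous_f l).comp ((ih.2 j).prodMk (continuous_coef i j))))
    · simp only [features_succ_snd]
      exact (F.continuous_q l).comp ((ih.2 j).prodMk (continuous_finsetSum _ fun i _ =>
        (F.continuous_g l).comp ((ih.1 i).prodMk (continuous_coef i j))))

theorem continuous_eval (F : MPGNN) : Continuous fun G : MILPGraph m n => F.eval G :=
  (PiLp.continuous_toLp 2 _).comp
    (continuous_pi fun j => F.continuous_r.comp <|
      (continuous_finsetSum _ fun i _ => (F.continuous_features _).1 i).prodMk <|
        (continuous_finsetSum _ fun j' _ => (F.continuous_features _).2 j').prodMk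
          ((F.continuous_features _).2 j))

end MPGNN

/-! ### Measurability of the strong branching scores -/

/-- The indicator of constraints that bound the left-hand side from above. -/
def ConstraintSense.upperFlag : ConstraintSense → ℝ
  | .le => 1
  | .eq => 1
  | .ge => 0

/-- The indicator of constraints that bound the left-hand side from below. -/
def ConstraintSense.lowerFlag : ConstraintSense → ℝ
  | .le => 0
  | .eq => 1
  | .ge => 1

/-- Written with flags, the condition is a pair of weak inequalities between functions continuous in
all data, the type included, and hence closed. -/
theorem ConstraintSense.holds_iff (s : ConstraintSense) (a b : ℝ) :
    s.Holds a b ↔ s.upperFlag * a ≤ s.upperFlag * b ∧ s.lowerFlag * b ≤ s.lowerFlag * a := by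
  cases s <;> simp [Holds, upperFlag, lowerFlag, le_antisymm_iff]

theorem LowerBound.holds_iff (l : LowerBound) (t : ℝ) :
    l.Holds t ↔ boundFlag l * boundValue l ≤ boundFlag l * t := by
  cases l <;> simp [Holds, boundFlag, boundValue]

theorem UpperBound.holds_iff (u : UpperBound) (t : ℝ) :
    u.Holds t ↔ boundFlag u * t ≤ boundFlag u * boundValue u := by
  cases u <;> simp [Holds, boundFlag, boundValue]

namespace MILPGraph

variable {m n : ℕ}

theorem isClosed_setOf_mem_lpFeasible :
    IsClosed {z : EuclideanSpace ℝ (Fin n) × MILPGraph m n | z.1 ∈ z.2.lpFeasible} := by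
  have hx : ∀ j, Continuous fun z : EuclideanSpace ℝ (Fin n) × MILPGraph m n => z.1 j :=
    fun j => (by fun_prop : Continuous fun x : EuclideanSpace ℝ (Fin n) => x j).comp continuous_fst
  have hsum : ∀ i, Continuous fun z : EuclideanSpace ℝ (Fin n) × MILPGraph m n =>
      ∑ j, z.2.coef i j * z.1 j := fun i => continuous_finsetSum _ fun j _ =>
    ((continuous_coef i j).comp continuous_snd).mul (hx j)
  have hs : ∀ (φ : ConstraintSense → ℝ) (i), Continuous
      fun z : EuclideanSpace ℝ (Fin n) × MILPGraph m n => φ (z.2.sense i) := fun φ i =>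
    (continuous_of_discreteTopology (f := φ)).comp ((continuous_sense i).comp continuous_snd)
  have hr := fun i => (continuous_rhs (m := m) (n := n) i).comp
    (continuous_snd (X := EuclideanSpace ℝ (Fin n)))
  have hl := fun j => (continuous_lower (m := m) (n := n) j).comp
    (continuous_snd (X := EuclideanSpace ℝ (Fin n)))
  have hu := fun j => (continuous_upper (m := m) (n := n) j).comp
    (continuous_snd (X := EuclideanSpace ℝ (Fin n)))
  simp only [lpFeasible, Set.mem_ofPred_eq, ConstraintSense.holds_iff, LowerBound.holds_iff,
    UpperBound.holds_iff]
  simp only [Set.ofPred_and, Set.ofPred_forall]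
  refine (isClosed_iInter fun i => ?_).inter (isClosed_iInter fun j => ?_)
  · exact (isClosed_le ((hs _ i).mul (hsum i)) ((hs _ i).mul (hr i))).inter
      (isClosed_le ((hs _ i).mul (hr i)) ((hs _ i).mul (hsum i)))
  · exact (isClosed_le ((continuous_boundFlag.comp (hl j)).mul (continuous_boundValue.comp (hl j)))
        ((continuous_boundFlag.comp (hl j)).mul (hx j))).inter
      (isClosed_le ((continuous_boundFlag.comp (hu j)).mul (hx j))
        ((continuous_boundFlag.comp (hu j)).mul (continuous_boundValue.comp (hu j))))

theorem continuous_objective :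
    Continuous fun z : EuclideanSpace ℝ (Fin n) × MILPGraph m n => z.2.objective z.1 :=
  continuous_finsetSum _ fun j _ => ((continuous_cost j).comp continuous_snd).mul
    ((by fun_prop : Continuous fun x : EuclideanSpace ℝ (Fin n) => x j).comp continuous_fst)

/-- The triples `(G, v, r)` such that the LP relaxation of `G` has a feasible point in `S` of
objective at most `v` and norm at most `r`. -/
def sublevel (S : Set (EuclideanSpace ℝ (Fin n))) : Set (MILPGraph m n × ℝ × ℝ) :=
  {q | ∃ x ∈ S, x ∈ q.1.lpFeasible ∧ q.1.objective x ≤ q.2.1 ∧ ‖x‖ ≤ q.2.2}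

/-- It is a countable union, over balls of radius `N`, of projections of closed sets along a compact
factor, and these are closed. -/
theorem measurableSet_sublevel {S : Set (EuclideanSpace ℝ (Fin n))} (hS : IsClosed S) :
    MeasurableSet (sublevel (m := m) S) := by
  have key : ∀ N : ℕ, IsClosed {q : MILPGraph m n × ℝ × ℝ | ∃ x ∈ Metric.closedBall 0 (N : ℝ),
      x ∈ S ∧ x ∈ q.1.lpFeasible ∧ q.1.objective x ≤ q.2.1 ∧ ‖x‖ ≤ q.2.2} := by
    intro N
    have : CompactSpace (Metric.closedBall (0 : EuclideanSpace ℝ (Fin n)) (N : ℝ)) :=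
      isCompact_iff_compactSpace.1 (isCompact_closedBall _ _)
    have hx : Continuous fun z : Metric.closedBall (0 : EuclideanSpace ℝ (Fin n)) (N : ℝ) ×
        (MILPGraph m n × ℝ × ℝ) => (z.1 : EuclideanSpace ℝ (Fin n)) :=
      continuous_subtype_val.comp continuous_fst
    have hxG := hx.prodMk (continuous_fst.comp continuous_snd)
    have hcl : IsClosed {z : Metric.closedBall (0 : EuclideanSpace ℝ (Fin n)) (N : ℝ) ×
        (MILPGraph m n × ℝ × ℝ) | (z.1 : EuclideanSpace ℝ (Fin n)) ∈ S ∧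
          (z.1 : EuclideanSpace ℝ (Fin n)) ∈ z.2.1.lpFeasible ∧
          z.2.1.objective z.1 ≤ z.2.2.1 ∧ ‖(z.1 : EuclideanSpace ℝ (Fin n))‖ ≤ z.2.2.2} :=
      (hS.preimage hx).inter ((isClosed_setOf_mem_lpFeasible.preimage hxG).inter
        ((isClosed_le (continuous_objective.comp hxG) (by fun_prop)).inter
          (isClosed_le hx.norm (by fun_prop))))
    convert isClosedMap_snd_of_compactSpace _ hcl using 1
    ext q
    simp only [Set.mem_ofPred_eq, Set.mem_image, Prod.exists, Subtype.exists, exists_prop]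
    constructor
    · rintro ⟨x, hxN, h⟩
      exact ⟨x, hxN, q.1, q.2.1, q.2.2, h, rfl⟩
    · rintro ⟨x, hxN, G, v, r, h, rfl⟩
      exact ⟨x, hxN, h⟩
  convert MeasurableSet.iUnion fun N => (key N).measurableSet using 1
  ext q
  simp only [sublevel, Set.mem_ofPred_eq, Set.mem_iUnion, mem_closedBall_zero_iff]
  constructor
  · rintro ⟨x, hx, h⟩
    obtain ⟨N, hN⟩ := exists_nat_ge ‖x‖
    exact ⟨N, x, hN, hx, h⟩
  · rintro ⟨N, x, -, hx, h⟩
    exact ⟨x, hx, h⟩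

/-- A value below `t` is witnessed by a feasible point and a rational between its objective and `t`;
the bound `N` only serves to fit the form of `sublevel`. -/
theorem measurable_lpValue : Measurable fun G : MILPGraph m n => G.lpValue := by
  refine measurable_of_Iio fun t => ?_
  have : (fun G : MILPGraph m n => G.lpValue) ⁻¹' Set.Iio t =
      ⋃ (a : ℚ) (_ : ((a : ℝ) : EReal) < t) (N : ℕ),
        {G | (G, (a : ℝ), (N : ℝ)) ∈ sublevel Set.univ} := by
    ext G
    simp only [lpValue, sublevel, Set.mem_preimage, Set.mem_Iio, iInf_lt_iff, Set.mem_iUnion,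
      Set.mem_ofPred_eq, Set.mem_univ, true_and, exists_prop]
    constructor
    · rintro ⟨x, hx, hxt⟩
      obtain ⟨a, ha, hat⟩ := EReal.lt_iff_exists_rat_btwn.1 hxt
      obtain ⟨N, hN⟩ := exists_nat_ge ‖x‖
      exact ⟨a, hat, N, x, hx, (EReal.coe_lt_coe_iff.1 ha).le, hN⟩
    · rintro ⟨a, hat, N, x, hx, hxa, -⟩
      exact ⟨x, hx, (EReal.coe_le_coe_iff.2 hxa).trans_lt hat⟩
  rw [this]
  refine .iUnion fun a => .iUnion fun _ => .iUnion fun N => ?_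
  exact (measurableSet_sublevel isClosed_univ).preimage (by fun_prop)

theorem mem_lpOptimal_iff {G : MILPGraph m n} {x : EuclideanSpace ℝ (Fin n)} :
    x ∈ G.lpOptimal ↔ x ∈ G.lpFeasible ∧ (G.objective x : EReal) ≤ G.lpValue := by
  simp [lpOptimal, lpValue]

theorem coe_toReal_lpValue {G : MILPGraph m n} (h : G.lpOptimal.Nonempty) :
    (G.lpValue.toReal : EReal) = G.lpValue := by
  obtain ⟨x, hx⟩ := h
  rw [mem_lpOptimal_iff] at hx
  refine EReal.coe_toReal (ne_top_of_le_ne_top (EReal.coe_ne_top (G.objective x)) ?_)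
    (ne_bot_of_le_ne_bot (EReal.coe_ne_bot _) hx.2)
  exact iInf₂_le x hx.1

theorem mem_lpOptimal_iff_of_coe {G : MILPGraph m n} (h : (G.lpValue.toReal : EReal) = G.lpValue)
    {x : EuclideanSpace ℝ (Fin n)} :
    x ∈ G.lpOptimal ↔ x ∈ G.lpFeasible ∧ G.objective x ≤ G.lpValue.toReal := by
  rw [mem_lpOptimal_iff, ← h, EReal.coe_le_coe_iff, EReal.toReal_coe]

theorem isClosed_lpOptimal (G : MILPGraph m n) : IsClosed G.lpOptimal := by
  have hG : Continuous fun x : EuclideanSpace ℝ (Fin n) => (x, G) := by fun_prop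
  have h : G.lpOptimal = {x | x ∈ G.lpFeasible} ∩
      {x | (G.objective x : EReal) ≤ G.lpValue} := Set.ext fun x => mem_lpOptimal_iff
  rw [h]
  exact (isClosed_setOf_mem_lpFeasible.preimage hG).inter (isClosed_le
    (continuous_coe_real_ereal.comp (continuous_objective.comp hG)) continuous_const)

/-- A nonempty closed set in finite dimension has a point nearest to the origin. -/
theorem isMinNormOptimal_lpSolution {G : MILPGraph m n} (h : G.lpOptimal.Nonempty) :
    G.IsMinNormOptimal G.lpSolution := by
  obtain ⟨x, hx, hdist⟩ := G.isClosed_lpOptimal.exists_infDist_eq_dist h 0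
  have hmin : G.IsMinNormOptimal x := ⟨hx, fun y hy => by
    have := Metric.infDist_le_dist_of_mem (x := 0) hy
    rwa [hdist, dist_zero_left, dist_zero_left] at this⟩
  rwa [hmin.lpSolution_eq]

theorem lpSolution_of_isEmpty {G : MILPGraph m n} (h : ¬ G.lpOptimal.Nonempty) :
    G.lpSolution = 0 :=
  dif_neg fun ⟨x, hx⟩ => h ⟨x, hx.1⟩

theorem measurable_toReal_lpValue : Measurable fun G : MILPGraph m n => G.lpValue.toReal :=
  measurable_lpValue.ereal_toReal

theorem measurableSet_lpOptimal_nonempty :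
    MeasurableSet {G : MILPGraph m n | G.lpOptimal.Nonempty} := by
  have : {G : MILPGraph m n | G.lpOptimal.Nonempty} =
      {G | (G.lpValue.toReal : EReal) = G.lpValue} ∩
        ⋃ N : ℕ, {G | (G, G.lpValue.toReal, (N : ℝ)) ∈ sublevel Set.univ} := by
    ext G
    simp only [sublevel, Set.mem_ofPred_eq, Set.mem_inter_iff, Set.mem_iUnion, Set.mem_univ,
      true_and]
    constructor
    · intro h
      obtain ⟨x, hx⟩ := h
      have hv := coe_toReal_lpValue ⟨x, hx⟩
      rw [mem_lpOptimal_iff_of_coe hv] at hx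
      obtain ⟨N, hN⟩ := exists_nat_ge ‖x‖
      exact ⟨hv, N, x, hx.1, hx.2, hN⟩
    · rintro ⟨hv, N, x, hx, hxv, -⟩
      exact ⟨x, (mem_lpOptimal_iff_of_coe hv).2 ⟨hx, hxv⟩⟩
  rw [this]
  refine (measurableSet_eq_fun measurable_toReal_lpValue.coe_real_ereal measurable_lpValue).inter
    (.iUnion fun N => ?_)
  exact (measurableSet_sublevel isClosed_univ).preimage
    (measurable_id.prodMk (measurable_toReal_lpValue.prodMk measurable_const))

/-- The norm comes first, because membership of the solution in a closed set is then expressible by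
`sublevel` with this norm as the bound. -/
theorem measurable_norm_lpSolution : Measurable fun G : MILPGraph m n => ‖G.lpSolution‖ := by
  classical
  refine measurable_of_Iic fun r => ?_
  have : (fun G : MILPGraph m n => ‖G.lpSolution‖) ⁻¹' Set.Iic r =
      {G | G.lpOptimal.Nonempty}.ite {G | (G, G.lpValue.toReal, r) ∈ sublevel Set.univ}
        {_G | 0 ≤ r} := by
    ext G
    by_cases h : G.lpOptimal.Nonempty
    · simp only [Set.mem_preimage, Set.mem_Iic, Set.ite, Set.mem_union,
        Set.mem_inter_iff, Set.mem_sdiff, Set.mem_ofPred_eq, h, not_true, and_true, and_false, or_false,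
        sublevel, Set.mem_univ, true_and]
      have hs := isMinNormOptimal_lpSolution h
      have hv := coe_toReal_lpValue h
      constructor
      · intro hr
        have := (mem_lpOptimal_iff_of_coe hv).1 hs.1
        exact ⟨_, this.1, this.2, hr⟩
      · rintro ⟨x, hx, hxv, hxr⟩
        exact (hs.2 x ((mem_lpOptimal_iff_of_coe hv).2 ⟨hx, hxv⟩)).trans hxr
    · simp [Set.ite, h, lpSolution_of_isEmpty h]
  rw [this]
  refine measurableSet_lpOptimal_nonempty.ite ?_ (.const _)
  exact (measurableSet_sublevel isClosed_univ).preimage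
    (measurable_id.prodMk (measurable_toReal_lpValue.prodMk measurable_const))

/-- By uniqueness, the solution lies in `S` iff some optimal point of `S` has norm at most that of
the solution. -/
theorem measurable_lpSolution : Measurable fun G : MILPGraph m n => G.lpSolution := by
  classical
  refine measurable_of_isClosed fun S hS => ?_
  have : (fun G : MILPGraph m n => G.lpSolution) ⁻¹' S =
      {G | G.lpOptimal.Nonempty}.ite
        {G | (G, G.lpValue.toReal, ‖G.lpSolution‖) ∈ sublevel S} {_G | 0 ∈ S} := by
    ext G
    by_cases h : G.lpOptimal.Nonempty
    · simp only [Set.mem_preimage, Set.ite, Set.mem_union,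
        Set.mem_inter_iff, Set.mem_sdiff, Set.mem_ofPred_eq, h, not_true, and_true, and_false, or_false, sublevel]
      have hs := isMinNormOptimal_lpSolution h
      have hv := coe_toReal_lpValue h
      constructor
      · intro hS
        have := (mem_lpOptimal_iff_of_coe hv).1 hs.1
        exact ⟨_, hS, this.1, this.2, le_rfl⟩
      · rintro ⟨x, hxS, hx, hxv, hxr⟩
        have hmin : G.IsMinNormOptimal x := ⟨(mem_lpOptimal_iff_of_coe hv).2 ⟨hx, hxv⟩,
          fun y hy => hxr.trans (hs.2 y hy)⟩
        rwa [hs.unique hmin]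
    · simp [Set.ite, h, lpSolution_of_isEmpty h]
  rw [this]
  refine measurableSet_lpOptimal_nonempty.ite ?_ (.const _)
  exact (measurableSet_sublevel hS).preimage
    (measurable_id.prodMk (measurable_toReal_lpValue.prodMk measurable_norm_lpSolution))

theorem measurable_sbScore (j : Fin n) : Measurable fun G : MILPGraph m n => G.sbScore j := by
  have hx : Measurable fun G : MILPGraph m n => G.lpSolution j :=
    (by fun_prop : Continuous fun x : EuclideanSpace ℝ (Fin n) => x j).measurable.comp
      measurable_lpSolution
  -- The rounded value ranges over the countable set `ℤ`, so it suffices to fix it; the modified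
  -- graph then depends continuously on `G`.
  have hdown : Measurable fun z : MILPGraph m n × ℤ =>
      (z.1.changeBounds j (z.1.lower j) (Sum.inl (z.2 : ℝ))).lpValue :=
    measurable_from_prod_countable_left fun k => measurable_lpValue.comp
      (continuous_changeBounds j (continuous_lower j)
        (continuous_const (y := Sum.inl (k : ℝ)))).measurable
  have hup : Measurable fun z : MILPGraph m n × ℤ =>
      (z.1.changeBounds j (Sum.inl (z.2 : ℝ)) (z.1.upper j)).lpValue :=
    measurable_from_prod_countable_left fun k => measurable_lpValue.comp
      (continuous_changeBounds j (continuous_const (y := Sum.inl (k : ℝ)))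
        (continuous_upper j)).measurable
  have hneg : Measurable fun G : MILPGraph m n => -G.lpValue :=
    continuous_neg.measurable.comp measurable_lpValue
  refine Measurable.ite ?_ (Measurable.mul ?_ ?_) measurable_const
  · exact (isClosed_singleton.preimage (continuous_isInt j)).measurableSet
  · exact (hdown.comp (measurable_id.prodMk hx.floor)).add hneg
  · exact (hup.comp (measurable_id.prodMk hx.ceil)).add hneg

theorem measurable_sbVector : Measurable fun G : MILPGraph m n => G.sbVector :=
  (PiLp.continuous_toLp 2 _).measurable.comp
    (measurable_pi_lambda _ fun j => (measurable_sbScore j).ereal_toReal)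

end MILPGraph

/-! ### Lusin's theorem and factorization through a quotient -/

/-- **Lusin's theorem**: a measurable function is continuous on a compact set whose complement in a
given measurable set has small measure. -/
theorem Measurable.exists_isCompact_continuousOn {X Y : Type*} [TopologicalSpace X] [T2Space X]
    [MeasurableSpace X] [BorelSpace X] [TopologicalSpace Y] [SecondCountableTopology Y]
    [MeasurableSpace Y] [OpensMeasurableSpace Y] {μ : Measure X} [IsFiniteMeasure μ]
    [μ.InnerRegularCompactLTTop] {f : X → Y} (hf : Measurable f) {s : Set X}
    (hs : MeasurableSet s) {ε : ENNReal} (hε : ε ≠ 0) :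
    ∃ K ⊆ s, IsCompact K ∧ ContinuousOn f K ∧ μ (s \ K) ≤ ε := by
  obtain ⟨b, hbc, -, hb⟩ := TopologicalSpace.exists_countable_basis Y
  have : Countable b := hbc.to_subtype
  obtain ⟨e, he0, he⟩ := ENNReal.exists_pos_sum_of_countable' (ENNReal.half_pos hε).ne' b
  have hU : ∀ U : b, MeasurableSet (f ⁻¹' (U : Set Y)) := fun U =>
    hf (hb.isOpen U.2).measurableSet
  -- Compact sets approximate both the preimage of each basic open set (`A`) and its complement
  -- (`B`).
  choose A hAs hA _ hAμ using fun U : b =>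
    (hs.inter (hU U)).exists_isCompact_isClosed_sdiff_lt (measure_ne_top μ _)
      (ENNReal.half_pos (he0 U).ne').ne'
  choose B hBs hB _ hBμ using fun U : b =>
    (hs.inter (hU U).compl).exists_isCompact_isClosed_sdiff_lt (measure_ne_top μ _)
      (ENNReal.half_pos (he0 U).ne').ne'
  -- `C` keeps the result compact and inside `s`, even when the basis is empty.
  obtain ⟨C, hCs, hC, -, hCμ⟩ :=
    hs.exists_isCompact_isClosed_sdiff_lt (measure_ne_top μ _) (ENNReal.half_pos hε).ne'
  refine ⟨C ∩ ⋂ U, (A U ∪ B U), fun x hx => hCs hx.1,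
    hC.inter_right (isClosed_iInter fun U => ((hA U).union (hB U)).isClosed), ?_, ?_⟩
  -- Within the compact set, the preimage of `U` is the complement of the closed set `B U`.
  · rw [continuousOn_iff_continuous_domRestrict, hb.continuous_iff]
    intro U hUb
    have hclosed : IsClosed (B ⟨U, hUb⟩) := (hB ⟨U, hUb⟩).isClosed
    convert (hclosed.preimage continuous_subtype_val).isOpen_compl using 1
    ext ⟨x, hx⟩
    simp only [Set.mem_preimage, Set.domRestrict_apply, Set.mem_compl_iff]
    refine ⟨fun hxU hxB => (hBs _ hxB).2 hxU, fun hxB => ?_⟩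
    rcases Set.mem_iInter.1 hx.2 ⟨U, hUb⟩ with h | h
    · exact (hAs _ h).2
    · exact absurd h hxB
  · have hsub : s \ (C ∩ ⋂ U, (A U ∪ B U)) ⊆ (s \ C) ∪ ⋃ U : b,
        (((s ∩ f ⁻¹' (U : Set Y)) \ A U) ∪ ((s ∩ (f ⁻¹' (U : Set Y))ᶜ) \ B U)) := by
      rintro x ⟨hxs, hx⟩
      by_cases hxC : x ∈ C
      · right
        have : ∃ U, x ∉ A U ∪ B U := by
          by_contra! h
          exact hx ⟨hxC, Set.mem_iInter.2 h⟩
        obtain ⟨U, hxU⟩ := this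
        rw [Set.mem_union, not_or] at hxU
        refine Set.mem_iUnion.2 ⟨U, ?_⟩
        by_cases hfx : x ∈ f ⁻¹' (U : Set Y)
        · exact Or.inl ⟨⟨hxs, hfx⟩, hxU.1⟩
        · exact Or.inr ⟨⟨hxs, hfx⟩, hxU.2⟩
      · exact Or.inl ⟨hxs, hxC⟩
    calc μ (s \ (C ∩ ⋂ U, (A U ∪ B U)))
        ≤ μ (s \ C) + ∑' U : b, (e U / 2 + e U / 2) := by
          refine (measure_mono hsub).trans ((measure_union_le _ _).trans ?_)
          gcongr
          refine (measure_iUnion_le _).trans (ENNReal.tsum_le_tsum fun U => ?_)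
          exact (measure_union_le _ _).trans (add_le_add (hAμ U).le (hBμ U).le)
      _ ≤ ε / 2 + ε / 2 := by
          simp_rw [ENNReal.add_halves (e _)]
          exact add_le_add hCμ.le he.le
      _ = ε := ENNReal.add_halves ε

/-- A continuous real function on a compact space that is constant on the fibres of a continuous
map `φ` to a normal Hausdorff space factors through `φ` by a continuous function. -/
theorem Continuous.exists_continuousMap_comp_eq {X Y : Type*} [TopologicalSpace X] [CompactSpace X]
    [TopologicalSpace Y] [T2Space Y] [NormalSpace Y] {φ : X → Y} (hφ : Continuous φ) {t : X → ℝ}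
    (ht : Continuous t) (hfac : t.FactorsThrough φ) : ∃ r : C(Y, ℝ), ∀ x, r (φ x) = t x := by
  let φ' : C(X, Set.range φ) := ⟨Set.rangeFactorization φ, hφ.subtype_mk _⟩
  -- A continuous map from a compact space onto a Hausdorff space is closed, hence a quotient map.
  have hq : Topology.IsQuotientMap φ' :=
    φ'.continuous.isClosedMap.isQuotientMap φ'.continuous Set.rangeFactorization_surjective
  have hfac' : Function.FactorsThrough (⟨t, ht⟩ : C(X, ℝ)) φ' := fun x y hxy => by
    have hxy' : φ x = φ y := congrArg Subtype.val hxy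
    exact hfac hxy'
  -- Tietze's theorem extends the factor from the compact range to all of `Y`.
  obtain ⟨r, hr⟩ := ContinuousMap.exists_restrict_eq (isCompact_range hφ).isClosed
    (hq.lift ⟨t, ht⟩ hfac')
  refine ⟨r, fun x => ?_⟩
  have h1 := DFunLike.congr_fun hr (φ' x)
  exact h1.trans (DFunLike.congr_fun (hq.lift_comp ⟨t, ht⟩ hfac') x)

/-! ### Exact representation on compact sets -/

namespace MILPGraph

variable {m n : ℕ}

/-- The argument of the readout function of `wlGNN`. -/
def wlReadout (D L : ℕ) (G : MILPGraph m n) (j : Fin n) :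
    (Fin (wlDim D L).1 → ℝ) × (Fin (wlDim D L).2 → ℝ) × (Fin (wlDim D L).2 → ℝ) :=
  (∑ i, G.wlFeatV D L i, ∑ j', G.wlFeatW D L j', G.wlFeatW D L j)

theorem eval_wlGNN (D L : ℕ) (r) (G : MILPGraph m n) (j : Fin n) :
    (wlGNN D L r).eval G j = r (G.wlReadout D L j) :=
  congrArg (fun X : (Fin m → Fin (wlDim D L).1 → ℝ) × (Fin n → Fin (wlDim D L).2 → ℝ) =>
    r (∑ i, X.1 i, ∑ j', X.2 j', X.2 j)) (features_wlGNN r G L)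

theorem continuous_wlReadout (D L : ℕ) (j : Fin n) :
    Continuous fun G : MILPGraph m n => G.wlReadout D L j :=
  (continuous_finsetSum _ fun i _ => ((wlGNN D 0 0).continuous_features L).1 i).prodMk
    ((continuous_finsetSum _ fun j' _ => ((wlGNN D 0 0).continuous_features L).2 j').prodMk
      (((wlGNN D 0 0).continuous_features L).2 j))

/-- MP-tractable graphs with the same argument of the readout function have the same strong
branching score. -/
theorem sbVector_eq_of_wlReadout_eq {D L : ℕ} (hm : m + m ≤ D) (hn : n + n ≤ D)
    (hL : L = wlRounds m n + 2) {G H : MILPGraph m n} (hG : G.MPTractable) (hH : H.MPTractable)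
    {j j' : Fin n} (h : G.wlReadout D L j = H.wlReadout D L j') :
    G.sbVector j = H.sbVector j' := by
  subst hL
  obtain ⟨σ, τ, hiso, rfl⟩ := exists_isIso_of_wlFeat_eq hm hn hG hH (congrArg Prod.fst h)
    (congrArg (fun x => x.2.1) h) (congrArg (fun x => x.2.2) h)
  exact (hiso.sbVector_apply j).symm

/-- Factoring over `K × Fin n` instead of node by node yields a single readout function for all
variables. -/
theorem exists_wlGNN_eval_eq_sbVector {D L : ℕ} (hm : m + m ≤ D) (hn : n + n ≤ D)
    (hL : L = wlRounds m n + 2) {K : Set (MILPGraph m n)} (hK : IsCompact K)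
    (hMP : ∀ G ∈ K, G.MPTractable) (hcont : ContinuousOn sbVector K) :
    ∃ r, ∀ G ∈ K, (wlGNN D L r).eval G = G.sbVector := by
  have : CompactSpace K := isCompact_iff_compactSpace.1 hK
  have hφ : Continuous fun z : K × Fin n => z.1.1.wlReadout D L z.2 :=
    continuous_prod_of_discrete_right.2 fun j =>
      (continuous_wlReadout D L j).comp continuous_subtype_val
  have ht : Continuous fun z : K × Fin n => z.1.1.sbVector z.2 :=
    continuous_prod_of_discrete_right.2 fun j =>
      (by fun_prop : Continuous fun x : EuclideanSpace ℝ (Fin n) => x j).comp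
        hcont.domRestrict
  obtain ⟨r, hr⟩ := hφ.exists_continuousMap_comp_eq ht fun x y h =>
    sbVector_eq_of_wlReadout_eq hm hn hL (hMP _ x.1.2) (hMP _ y.1.2) h
  refine ⟨r, fun G hG => ?_⟩
  ext j
  rw [eval_wlGNN]
  exact hr (⟨G, hG⟩, j)

/-- On a compact set of MP-tractable graphs on which the strong branching scores are continuous,
they are computed by a message-passing GNN. -/
theorem exists_eval_eq_sbVector {K : Set (MILPGraph m n)} (hK : IsCompact K)
    (hMP : ∀ G ∈ K, G.MPTractable) (hcont : ContinuousOn sbVector K) :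
    ∃ F : MPGNN, ∀ G ∈ K, F.eval G = G.sbVector := by
  obtain ⟨r, hr⟩ := exists_wlGNN_eval_eq_sbVector (Nat.le_add_right (m + m) (n + n))
    (Nat.le_add_left (n + n) (m + m)) rfl hK hMP hcont
  exact ⟨_, hr⟩

end MILPGraph

end

/-! ### The probabilistic statement -/

theorem mainTheorem1 (m n : ℕ) (P : Measure (MILPGraph m n)) [IsProbabilityMeasure P]
    (hSB : ∀ᵐ G ∂P, G.SBFinite) (hMP : ∀ᵐ G ∂P, G.MPTractable)
    (ε δ : ℝ) (hε : 0 < ε) (hδ : 0 < δ) :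
    ∃ F : MPGNN,
      NullMeasurableSet {G : MILPGraph m n | G.SBFinite ∧ ‖F.eval G - G.sbVector‖ ≤ δ} P ∧
      1 - ε ≤ P.real {G : MILPGraph m n | G.SBFinite ∧ ‖F.eval G - G.sbVector‖ ≤ δ} := by
  -- Excluding a measurable null set avoids any measurability question about `SBFinite` and
  -- `MPTractable`.
  obtain ⟨t, hst, ht, htP⟩ := exists_measurable_superset_of_null (hSB.and hMP)
  have hgood : ∀ G ∈ tᶜ, G.SBFinite ∧ G.MPTractable := fun G hG => by
    by_contra h
    exact hG (hst h)
  obtain ⟨K, hKs, hK, hcont, hKP⟩ :=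
    MILPGraph.measurable_sbVector.exists_isCompact_continuousOn (μ := P) ht.compl
      (ENNReal.ofReal_pos.2 hε).ne'
  obtain ⟨F, hF⟩ := MILPGraph.exists_eval_eq_sbVector hK (fun G hG => (hgood G (hKs hG)).2) hcont
  refine ⟨F, ?_, ?_⟩
  · have hle : MeasurableSet {G : MILPGraph m n | ‖F.eval G - G.sbVector‖ ≤ δ} :=
      measurableSet_le (F.continuous_eval.measurable.sub MILPGraph.measurable_sbVector).norm
        measurable_const
    -- Almost surely the finiteness condition holds, so the event agrees up to a null set with the
    -- Borel event without it.
    refine hle.nullMeasurableSet.congr ?_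
    filter_upwards [hSB] with G hG
    exact propext ⟨fun h => ⟨hG, h⟩, fun h => h.2⟩
  · have hKsub : K ⊆ {G : MILPGraph m n | G.SBFinite ∧ ‖F.eval G - G.sbVector‖ ≤ δ} :=
      fun G hG => ⟨(hgood G (hKs hG)).1, by rw [hF G hG, sub_self, norm_zero]; exact hδ.le⟩
    have hcompl : P.real Kᶜ ≤ ε := by
      refine ENNReal.toReal_le_of_le_ofReal hε.le ((measure_mono (t := t ∪ tᶜ \ K) ?_).trans
        ((measure_union_le _ _).trans (by rwa [htP, zero_add])))
      intro G hG
      by_cases h : G ∈ t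
      · exact Or.inl h
      · exact Or.inr ⟨h, hG⟩
    rw [probReal_compl_eq_one_sub hK.measurableSet] at hcompl
    have := measureReal_mono (μ := P) hKsub
    linarith
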